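/- Let $\nu:[-\tfrac12,\tfrac12]\to\mathbb{R}$ be a positive, convex $C^2$ function (the dimensionless viscosity of the conductive state), let $Pr>0$ be the Prandtl number and let $k\in\mathbb{R}$, $k\neq0$, be a wavenumber. Write $D=d/dz$ and $\mathcal{P}f=D(\nu Df)-k^2\nu f$. For a Rayleigh number $R>0$, a number $\sigma\in\mathbb{C}$ is called an eigenvalue if there are complex functions $(Z,W,\Theta)\neq(0,0,0)$ on $[-\tfrac12,\tfrac12]$, with $Z,\Theta$ of class $C^2$ and $W$ of class $C^4$, such that $$\frac{\sigma}{Pr}Z=\nu(D^2-k^2)Z+\nu' DZ,\qquad \sigma\Theta=(D^2-k^2)\Theta+W,$$ $$\frac{\sigma}{Pr}(D^2-k^2)W=-Rk^2\Theta-k^2\mathcal{P}W+D(\mathcal{P}(DW))+k^2\nu''W,$$ $$Z=W=DW=\Theta=0\ \text{ at } z=-\tfrac12,\qquad Z=W=D^2W=\Theta=0\ \text{ at } z=\tfrac12 .$$ It is called a convective eigenvalue if moreover $(W,\Theta)\neq(0,0)$ can be chosen. Put $\widetilde R=R/k^4$ and $\hat\sigma=\sigma/k^2$. The growth rate $\hat\sigma(\widetilde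 R)$ is $k^{-2}$ times the greatest real part of the convective eigenvalues for $R=k^4\widetilde R$. Then for every $\widetilde R>0$ this greatest real part exists (and is attained); there are values $\widetilde R>0$ for which $\hat\sigma(\widetilde R)>0$ and values $\widetilde R>0$ for which $\hat\sigma(\widetilde R)<0$; and exchange of stability holds, i.e. the conductive state loses stability to modes of wavenumber $k$ through a stationary bifurcation in the following sense: for every $\widetilde R>0$ all eigenvalues are real, $\hat\sigma$ is a continuous function of $\widetilde R\in(0,\infty)$, and there is a critical value $\widetilde R_o=\widetilde R_o(k)>0$ such that - for $0<\widetilde R<\widetilde R_o$ one has $\hat\sigma(\widetilde R)<0$ and every eigenvalue is negative; - for $\widetilde R=\widetilde R_o$ one has $\hat\sigma(\widetilde R_o)=0$, the number $0$ is a convective eigenvalue, and every other eigenvalue is negative; - for $\widetilde R>\widetilde R_o$ one has $\hat\sigma(\widetilde R)>0$. -/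

import Mathlib

namespace Convection

/-- The vertical extent `[-1/2, 1/2]` of the (dimensionless) fluid layer. -/
def layer : Set ℝ := Set.Icc (-(1 / 2)) (1 / 2)

/-- The derivative `D = d/dz` on the layer (one-sided at the two plates). -/
noncomputable def D (f : ℝ → ℂ) : ℝ → ℂ := derivWithin f layer

/-- First derivative of the real viscosity profile on the layer. -/
noncomputable def dVisc (ν : ℝ → ℝ) : ℝ → ℝ := derivWithin ν layer

/-- The operator `𝒫 f = D (ν D f) - k² ν f`. -/
noncomputable def viscOp (ν : ℝ → ℝ) (k : ℝ) (f : ℝ → ℂ) : ℝ → ℂ :=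
  fun z => D (fun y => (ν y : ℂ) * D f y) z - (k : ℂ) ^ 2 * (ν z : ℂ) * f z

/-- `(Z, W, Θ)` (vertical vorticity, vertical velocity, temperature) solves the linear normal mode
problem of the conductive state with viscosity profile `ν`, Prandtl number `Pr`, Rayleigh number
`R`, wavenumber `k` and (complex) growth rate `σ`. The bottom plate `z = -1/2` is rigid, the
top `z = 1/2` is free-slip. The values of `Z`, `W`, `Θ` outside the layer are irrelevant. -/
structure IsNormalMode (ν : ℝ → ℝ) (Pr R k : ℝ) (σ : ℂ) (Z W Θ : ℝ → ℂ) : Prop where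
  contDiff_Z : ContDiffOn ℝ 2 Z layer
  contDiff_W : ContDiffOn ℝ 4 W layer
  contDiff_Θ : ContDiffOn ℝ 2 Θ layer
  vorticity : ∀ z ∈ layer,
    σ / (Pr : ℂ) * Z z
      = (ν z : ℂ) * (D (D Z) z - (k : ℂ) ^ 2 * Z z) + (dVisc ν z : ℂ) * D Z z
  heat : ∀ z ∈ layer,
    σ * Θ z = (D (D Θ) z - (k : ℂ) ^ 2 * Θ z) + W z
  momentum : ∀ z ∈ layer,
    σ / (Pr : ℂ) * (D (D W) z - (k : ℂ) ^ 2 * W z)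
      = -((R : ℂ) * (k : ℂ) ^ 2 * Θ z) - (k : ℂ) ^ 2 * viscOp ν k W z
        + D (viscOp ν k (D W)) z
        + (k : ℂ) ^ 2 * ((derivWithin (dVisc ν) layer z : ℝ) : ℂ) * W z
  bottom : Z (-(1 / 2)) = 0 ∧ W (-(1 / 2)) = 0 ∧ D W (-(1 / 2)) = 0 ∧ Θ (-(1 / 2)) = 0
  top : Z (1 / 2) = 0 ∧ W (1 / 2) = 0 ∧ D (D W) (1 / 2) = 0 ∧ Θ (1 / 2) = 0

/-- `σ` is an eigenvalue of the full normal mode problem: there is a nontrivial `(Z, W, Θ)`. -/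
def IsEigenvalue (ν : ℝ → ℝ) (Pr R k : ℝ) (σ : ℂ) : Prop :=
  ∃ Z W Θ : ℝ → ℂ, IsNormalMode ν Pr R k σ Z W Θ ∧
    ∃ z ∈ layer, Z z ≠ 0 ∨ W z ≠ 0 ∨ Θ z ≠ 0

/-- `σ` is an eigenvalue of the coupled velocity-temperature problem: there is a normal mode whose
part `(W, Θ)` is nontrivial. (The equation for `Z` decouples and does not involve `R`.) -/
def IsConvectiveEigenvalue (ν : ℝ → ℝ) (Pr R k : ℝ) (σ : ℂ) : Prop :=
  ∃ Z W Θ : ℝ → ℂ, IsNormalMode ν Pr R k σ Z W Θ ∧ ∃ z ∈ layer, W z ≠ 0 ∨ Θ z ≠ 0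

/-- `s` is the growth rate of the velocity-temperature perturbations with wavenumber `k`: the
greatest real part of an eigenvalue, and it is attained. -/
def IsGrowthRate (ν : ℝ → ℝ) (Pr R k s : ℝ) : Prop :=
  IsGreatest {x : ℝ | ∃ σ : ℂ, IsConvectiveEigenvalue ν Pr R k σ ∧ x = σ.re} s

/-- Exchange of stability at wavenumber `k`, in the rescaled variables `R = k⁴ R̃`, `σ = k² σ̂`,
where `σhat R̃` is the rescaled growth rate: for `R̃ > 0` all eigenvalues are real, the growth rate
depends continuously on `R̃`, and there is a critical value `R0` below which every mode decays,
at which `0` is an eigenvalue while all other modes decay (a stationary marginal state), and above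
which some mode grows. -/
def ExchangeOfStability (ν : ℝ → ℝ) (Pr k : ℝ) (σhat : ℝ → ℝ) : Prop :=
  (∀ Rt : ℝ, 0 < Rt → ∀ σ : ℂ, IsEigenvalue ν Pr (k ^ 4 * Rt) k σ → σ.im = 0) ∧
  ContinuousOn σhat (Set.Ioi 0) ∧
  ∃ R0 : ℝ, 0 < R0 ∧
    (∀ Rt : ℝ, 0 < Rt → Rt < R0 →
      σhat Rt < 0 ∧ ∀ σ : ℂ, IsEigenvalue ν Pr (k ^ 4 * Rt) k σ → σ.re < 0) ∧
    (σhat R0 = 0 ∧ IsConvectiveEigenvalue ν Pr (k ^ 4 * R0) k 0 ∧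
      ∀ σ : ℂ, IsEigenvalue ν Pr (k ^ 4 * R0) k σ → σ ≠ 0 → σ.re < 0) ∧
    (∀ Rt : ℝ, R0 < Rt → 0 < σhat Rt)

end Convection

namespace Convection

/-! Choose `r > 0` with `r² = R k²` and replace the temperature `Θ` by `rΘ`. The
velocity-temperature problem then becomes symmetric: in weak form it reads `a(w,u) - r b(w,u) + σ
m(w,u) = 0` for all test functions `w`, with symmetric forms `a` (`dissipation`), `b` (`coupling`)
and `m` (`inertia`). Convexity of the viscosity enters through `ν'' ≥ 0`, which makes `a` dominate a
positive multiple of `m`. Symmetry forces every convective eigenvalue to be real and at most the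
supremum `growth r` of `(r b(u,u) - a(u,u)) / m(u,u)`.

As a supremum of affine functions of `r`, `growth` is convex on `ℝ`, hence continuous. It is
negative at `r = 0` and positive for large `r`, so convexity leaves exactly one sign change on `r >
0` (`exists_critical`).

The supremum must also be an eigenvalue (`exists_solution_growth`). Writing the problem as a
first-order system with Volterra inverse and shooting from the bottom plate gives a Fredholm
alternative. If only the zero solution existed, the inhomogeneous problem would be solvable with
bounds; two uses of Cauchy-Schwarz would then make `a - r b + growth r • m` bounded below by a
positive multiple of `m`, so `growth r` could be lowered.

The vorticity equation decouples, and an energy identity makes its eigenvalues real and negative.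

A perturbation is stored as `(W'', Θ')` and integrated from the bottom, so the bottom conditions
hold by construction. At the top only `W = Θ = 0` is imposed on test functions; `W'' = 0` is the
natural boundary condition. -/

/-- Continuous real functions on the layer. -/
abbrev Profile := C(layer, ℝ)

instance : CompactSpace layer := isCompact_iff_compactSpace.mp isCompact_Icc

theorem half_le : (-(1 / 2) : ℝ) ≤ 1 / 2 := by norm_num

/-- The bottom plate. -/
noncomputable def bottomPlate : layer := ⟨-(1 / 2), Set.left_mem_Icc.2 half_le⟩

/-- The top plate. -/
noncomputable def topPlate : layer := ⟨1 / 2, Set.right_mem_Icc.2 half_le⟩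

theorem uniqueDiffOn_layer : UniqueDiffOn ℝ layer := uniqueDiffOn_Icc (by norm_num)

/-! ### Calculus of continuous functions on the layer. -/

namespace Profile

/-- The extension of a profile to the real line by its boundary values. -/
noncomputable def ext (f : Profile) (z : ℝ) : ℝ := f (Set.projIcc (-(1 / 2)) (1 / 2) half_le z)

theorem ext_of_mem (f : Profile) {z : ℝ} (hz : z ∈ layer) : f.ext z = f ⟨z, hz⟩ := by
  unfold ext
  congr 1
  exact Set.projIcc_of_mem half_le hz

theorem ext_coe (f : Profile) (z : layer) : f.ext z = f z := f.ext_of_mem z.2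

@[fun_prop]
theorem continuous_ext (f : Profile) : Continuous f.ext :=
  f.continuous.comp continuous_projIcc

theorem abs_ext_le (f : Profile) (z : ℝ) : |f.ext z| ≤ ‖f‖ := f.norm_coe_le_norm _

@[simp] theorem ext_add (f g : Profile) (z : ℝ) : (f + g).ext z = f.ext z + g.ext z := rfl
@[simp] theorem ext_sub (f g : Profile) (z : ℝ) : (f - g).ext z = f.ext z - g.ext z := rfl
@[simp] theorem ext_neg (f : Profile) (z : ℝ) : (-f).ext z = -f.ext z := rfl
@[simp] theorem ext_mul (f g : Profile) (z : ℝ) : (f * g).ext z = f.ext z * g.ext z := rfl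
@[simp] theorem ext_smul (c : ℝ) (f : Profile) (z : ℝ) : (c • f).ext z = c * f.ext z := rfl

/-- The primitive of a profile that vanishes at the bottom plate. -/
noncomputable def primitive : Profile →L[ℝ] Profile :=
  LinearMap.mkContinuous
    { toFun := fun f => ⟨fun z => ∫ s in (-(1 / 2))..(z : ℝ), f.ext s,
        (intervalIntegral.continuous_primitive
          (fun _ _ => f.continuous_ext.intervalIntegrable _ _) _).comp continuous_subtype_val⟩
      map_add' := fun f g => by
        ext z
        simpa using intervalIntegral.integral_add (f.continuous_ext.intervalIntegrable _ _)
          (g.continuous_ext.intervalIntegrable _ _)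
      map_smul' := fun c f => by
        ext z
        simp } 1 (fun f => by
      rw [one_mul, ContinuousMap.norm_le _ (norm_nonneg f)]
      intro z
      have h := intervalIntegral.norm_integral_le_of_norm_le_const (a := -(1 / 2)) (b := (z : ℝ))
        (f := f.ext) (C := ‖f‖) (fun s _ => f.abs_ext_le s)
      refine h.trans (mul_le_of_le_one_right (norm_nonneg f) ?_)
      have hz := z.2
      simp only [layer, Set.mem_Icc] at hz
      rw [abs_le]; constructor <;> linarith)

theorem primitive_apply (f : Profile) (z : layer) :
    primitive f z = ∫ s in (-(1 / 2))..(z : ℝ), f.ext s := rfl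

@[simp] theorem primitive_bottom (f : Profile) : primitive f bottomPlate = 0 := by
  simp [primitive_apply, bottomPlate]

theorem abs_primitive_le (f : Profile) : ‖primitive f‖ ≤ ‖f‖ := by
  simpa using primitive.le_of_opNorm_le (LinearMap.mkContinuous_norm_le _ zero_le_one _) f

/-- `f'` is the derivative of `f` on the layer. -/
def IsDeriv (f f' : Profile) : Prop :=
  ∀ z ∈ layer, HasDerivWithinAt f.ext (f'.ext z) layer z

theorem isDeriv_primitive (f : Profile) : IsDeriv (primitive f) f := by
  intro z hz
  have h : HasDerivAt (fun t => ∫ s in (-(1 / 2))..t, f.ext s) (f.ext z) z :=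
    intervalIntegral.integral_hasDerivAt_right (f.continuous_ext.intervalIntegrable _ _)
      (f.continuous_ext.stronglyMeasurableAtFilter _ _) f.continuous_ext.continuousAt
  refine h.hasDerivWithinAt.congr (fun y hy => ?_) ?_
  · rw [ext_of_mem _ hy, primitive_apply]
  · rw [ext_of_mem _ hz, primitive_apply]

theorem IsDeriv.add {f f' g g' : Profile} (hf : IsDeriv f f') (hg : IsDeriv g g') :
    IsDeriv (f + g) (f' + g') := fun z hz => (hf z hz).add (hg z hz)

theorem IsDeriv.sub {f f' g g' : Profile} (hf : IsDeriv f f') (hg : IsDeriv g g') :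
    IsDeriv (f - g) (f' - g') := fun z hz => (hf z hz).sub (hg z hz)

theorem IsDeriv.mul {f f' g g' : Profile} (hf : IsDeriv f f') (hg : IsDeriv g g') :
    IsDeriv (f * g) (f' * g + f * g') := fun z hz => (hf z hz).mul (hg z hz)

theorem IsDeriv.smul {f f' : Profile} (c : ℝ) (hf : IsDeriv f f') :
    IsDeriv (c • f) (c • f') := fun z hz => (hf z hz).const_mul c

theorem isDeriv_const (c : ℝ) : IsDeriv (ContinuousMap.const layer c) 0 :=
  fun z _ => hasDerivWithinAt_const z layer c

theorem IsDeriv.primitive_apply {f f' : Profile} (hf : IsDeriv f f') (z : layer) :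
    primitive f' z = f z - f bottomPlate := by
  have hz : (-(1 / 2) : ℝ) ≤ z := z.2.1
  have hsub : Set.Icc (-(1 / 2)) (z : ℝ) ⊆ layer := Set.Icc_subset_Icc_right z.2.2
  have h := intervalIntegral.integral_eq_sub_of_hasDeriv_right_of_le hz
    (f.continuous_ext.continuousOn) (f' := f'.ext)
    (fun x hx => ((hf x (hsub (Set.Ioo_subset_Icc_self hx))).hasDerivAt
      (Icc_mem_nhds hx.1 (hx.2.trans_le z.2.2))).hasDerivWithinAt)
    (f'.continuous_ext.intervalIntegrable _ _)
  rw [Profile.primitive_apply, h, f.ext_coe, ← f.ext_coe bottomPlate]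
  rfl

theorem IsDeriv.eq_primitive {f f' : Profile} (hf : IsDeriv f f') (h0 : f bottomPlate = 0) :
    f = primitive f' := by
  ext z
  rw [hf.primitive_apply, h0, sub_zero]

theorem isDeriv_of_eq_const_add {f f' : Profile} {c : ℝ}
    (h : f = ContinuousMap.const layer c + primitive f') : IsDeriv f f' := by
  rw [h]
  simpa using (isDeriv_const c).add (isDeriv_primitive f')

theorem IsDeriv.unique {f f₁ f₂ : Profile} (h₁ : IsDeriv f f₁) (h₂ : IsDeriv f f₂) : f₁ = f₂ := by
  ext z
  have := (uniqueDiffOn_layer z z.2).eq_deriv layer (h₁ z z.2) (h₂ z z.2)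
  rwa [ext_coe, ext_coe] at this

/-- The integral over the layer. -/
noncomputable def integral : Profile →L[ℝ] ℝ :=
  (ContinuousMap.evalCLM ℝ topPlate).comp primitive

theorem IsDeriv.integral {f f' : Profile} (hf : IsDeriv f f') :
    Profile.integral f' = f topPlate - f bottomPlate := hf.primitive_apply topPlate

theorem mul_integral (c : ℝ) (f : Profile) : c * integral f = integral (c • f) :=
  (map_smul integral c f).symm

theorem integral_nonneg {f : Profile} (hf : ∀ z, 0 ≤ f z) : 0 ≤ integral f :=
  intervalIntegral.integral_nonneg half_le fun _ _ => hf _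

theorem integral_mono {f g : Profile} (h : ∀ z, f z ≤ g z) : integral f ≤ integral g := by
  rw [← sub_nonneg, ← map_sub integral]
  exact integral_nonneg fun z => sub_nonneg.2 (h z)

theorem integral_pos {f : Profile} (hf : ∀ z, 0 ≤ f z) {z : layer} (hz : f z ≠ 0) :
    0 < integral f := by
  refine intervalIntegral.integral_pos (by norm_num : (-(1 / 2) : ℝ) < 1 / 2)
    f.continuous_ext.continuousOn (fun x _ => hf _) ⟨z, z.2, ?_⟩
  rw [ext_coe]
  exact lt_of_le_of_ne (hf z) (Ne.symm hz)

theorem abs_integral_le (f : Profile) : |integral f| ≤ ‖f‖ :=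
  ((primitive f).norm_coe_le_norm topPlate).trans (abs_primitive_le f)

/-- The Cauchy-Schwarz inequality against the indicator of `[-1/2, z]`. -/
theorem sq_primitive_le (f : Profile) (z : layer) :
    (primitive f z) ^ 2 ≤ integral (f * f) := by
  -- Subtracting `c = ∫ f` itself, rather than the mean, suffices: the interval has length at most
  -- 1, so `0 ≤ ∫ (f - c)²` gives `∫ f² ≥ (2 - (z + 1/2)) c² ≥ c²`.
  set c := primitive f z
  have hz : (-(1 / 2) : ℝ) ≤ z := z.2.1
  have hz' : (z : ℝ) ≤ 1 / 2 := z.2.2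
  have h1 : 0 ≤ ∫ s in (-(1 / 2))..(z : ℝ), (f.ext s - c) ^ 2 :=
    intervalIntegral.integral_nonneg hz fun s _ => sq_nonneg _
  have hi : ∀ {g : ℝ → ℝ} (_ : Continuous g) (a b : ℝ),
    IntervalIntegrable g MeasureTheory.volume a b := fun h a b => h.intervalIntegrable a b
  have h2 : ∫ s in (-(1 / 2))..(z : ℝ), (f.ext s - c) ^ 2
      = (∫ s in (-(1 / 2))..(z : ℝ), f.ext s * f.ext s) - 2 * c * c + (z + 1 / 2) * c ^ 2 := by
    have : ∀ s, (f.ext s - c) ^ 2 = f.ext s * f.ext s - 2 * c * f.ext s + c ^ 2 :=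
      fun s => by ring
    simp_rw [this]
    rw [intervalIntegral.integral_add (hi (by fun_prop) _ _) (hi (by fun_prop) _ _),
      intervalIntegral.integral_sub (hi (by fun_prop) _ _) (hi (by fun_prop) _ _),
      intervalIntegral.integral_const_mul, intervalIntegral.integral_const, smul_eq_mul,
      ← Profile.primitive_apply]
    ring
  have h3 : ∫ s in (-(1 / 2))..(z : ℝ), f.ext s * f.ext s ≤ integral (f * f) :=
    intervalIntegral.integral_mono_interval le_rfl hz hz'
      (Filter.Eventually.of_forall fun s => mul_self_nonneg _) (hi (by fun_prop) _ _)
  nlinarith [sq_nonneg c]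

end Profile

open Profile

/-! ### Linear systems of differential equations and shooting. -/

section LinearSystem

variable {n : ℕ} (A : Fin n → Fin n → Profile)

/-- The Volterra operator `y ↦ ∫ A y` of the linear system `y' = A y`. -/
noncomputable def volterra : (Fin n → Profile) →L[ℝ] (Fin n → Profile) :=
  ContinuousLinearMap.pi fun i => primitive.comp
    (∑ j, (ContinuousLinearMap.mul ℝ Profile (A i j)).comp (ContinuousLinearMap.proj j))

theorem volterra_apply (y : Fin n → Profile) (i : Fin n) :
    volterra A y i = primitive (∑ j, A i j * y j) := by
  simp [volterra]

/-- Each application integrates once more from the bottom, turning `(s + 1/2)^m / m!` into its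
primitive; this is the source of the factorial. -/
theorem abs_volterra_pow_le (y : Fin n → Profile) (m : ℕ) (i : Fin n) (z : layer) :
    |(volterra A ^ m) y i z|
      ≤ ‖y‖ * (∑ i, ∑ j, ‖A i j‖) ^ m * ((z + 1 / 2) ^ m / m.factorial) := by
  induction m generalizing i z with
  | zero => simpa using ((y i).norm_coe_le_norm z).trans (norm_le_pi_norm y i)
  | succ m ih =>
    set κ := ∑ i, ∑ j, ‖A i j‖
    have hκ : ∑ j, ‖A i j‖ ≤ κ :=
      Finset.single_le_sum (f := fun i => ∑ j, ‖A i j‖)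
        (fun i _ => Finset.sum_nonneg fun j _ => norm_nonneg _) (Finset.mem_univ i)
    have hκ0 : 0 ≤ κ := Finset.sum_nonneg fun i _ => Finset.sum_nonneg fun j _ => norm_nonneg _
    have hz : (-(1 / 2) : ℝ) ≤ z := z.2.1
    rw [pow_succ', mul_apply_eq_comp, volterra_apply, Profile.primitive_apply,
      ← Real.norm_eq_abs]
    set u := (volterra A ^ m) y
    have hb : ∀ s ∈ Set.Ioc (-(1 / 2) : ℝ) z, ‖(∑ j, A i j * u j).ext s‖
        ≤ ‖y‖ * κ ^ (m + 1) * ((s + 1 / 2) ^ m / m.factorial) := by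
      intro s hs
      have hs' : s ∈ layer := ⟨hs.1.le, hs.2.trans z.2.2⟩
      have hs0 : 0 ≤ s + 1 / 2 := by linarith [hs.1]
      rw [ext_of_mem _ hs', ContinuousMap.sum_apply]
      calc ‖∑ j, (A i j * u j) ⟨s, hs'⟩‖
          ≤ ∑ j, ‖A i j‖ * (‖y‖ * κ ^ m * ((s + 1 / 2) ^ m / m.factorial)) := by
            refine norm_sum_le_of_le _ fun j _ => ?_
            rw [ContinuousMap.mul_apply, norm_mul]
            exact mul_le_mul ((A i j).norm_coe_le_norm _) (ih j ⟨s, hs'⟩) (norm_nonneg _)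
              (norm_nonneg _)
        _ ≤ κ * (‖y‖ * κ ^ m * ((s + 1 / 2) ^ m / m.factorial)) := by
            rw [← Finset.sum_mul]
            gcongr
        _ = _ := by ring
    refine (intervalIntegral.norm_integral_le_of_norm_le hz
      (Filter.Eventually.of_forall hb) (Continuous.intervalIntegrable (by fun_prop) _ _)).trans ?_
    rw [intervalIntegral.integral_const_mul, intervalIntegral.integral_div,
      intervalIntegral.integral_comp_add_right (fun x => x ^ m), integral_pow]
    refine le_of_eq ?_
    rw [Nat.factorial_succ]
    have : (m.factorial : ℝ) ≠ 0 := by positivity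
    push_cast
    have : (m : ℝ) + 1 ≠ 0 := by positivity
    field_simp
    ring

/-- The factorial makes some power `V^m` a strict contraction, so `1 - V^m` is a unit. It factors as
`1 - V` times a commuting geometric sum, hence `1 - V` is a unit too, whatever the size of `A`. -/
theorem isUnit_one_sub_volterra : IsUnit (1 - volterra A) := by
  set κ := ∑ i, ∑ j, ‖A i j‖
  have hκ0 : 0 ≤ κ := Finset.sum_nonneg fun i _ => Finset.sum_nonneg fun j _ => norm_nonneg _
  obtain ⟨m, hm⟩ := ((FloorSemiring.tendsto_pow_div_factorial_atTop κ).eventually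
    (gt_mem_nhds (zero_lt_one' ℝ))).exists
  have hnorm : ‖volterra A ^ m‖ ≤ κ ^ m / m.factorial := by
    refine ContinuousLinearMap.opNorm_le_bound _ (by positivity) fun y => ?_
    rw [pi_norm_le_iff_of_nonneg (by positivity)]
    intro i
    rw [ContinuousMap.norm_le _ (by positivity)]
    intro z
    refine (abs_volterra_pow_le A y m i z).trans ?_
    have h0 : (0 : ℝ) ≤ z + 1 / 2 := by linarith [z.2.1]
    have h1 : (z : ℝ) + 1 / 2 ≤ 1 := by linarith [z.2.2]
    calc ‖y‖ * κ ^ m * ((z + 1 / 2) ^ m / m.factorial)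
        ≤ ‖y‖ * κ ^ m * (1 / m.factorial) := by
          gcongr
          exact pow_le_one₀ h0 h1
      _ = _ := by ring
  have hu := isUnit_one_sub_of_norm_lt_one (R := (Fin n → Profile) →L[ℝ] (Fin n → Profile)) (hnorm.trans_lt hm)
  have hc : Commute (1 - volterra A) (∑ i ∈ Finset.range m, volterra A ^ i) := by
    rw [Commute, SemiconjBy, mul_neg_geom_sum, geom_sum_mul_neg]
  rw [← mul_neg_geom_sum, hc.isUnit_mul_iff] at hu
  exact hu.1

/-- The Fredholm alternative for linear boundary value problems: the initial value `c` ranges over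
a finite-dimensional space `P`, and `β` collects as many boundary conditions. -/
theorem boundaryValue_alternative {P : Type*} [NormedAddCommGroup P] [NormedSpace ℝ P]
    [FiniteDimensional ℝ P] (ι : P →L[ℝ] (Fin n → Profile)) (β : (Fin n → Profile) →L[ℝ] P) :
    (∃ c y, c ≠ 0 ∧ y = ι c + volterra A y ∧ β y = 0) ∨
    ∃ C : ℝ, 0 ≤ C ∧ ∀ h, ∃ c y, y = ι c + volterra A y + h ∧ β y = 0 ∧ ‖y‖ ≤ C * ‖h‖ := by
  obtain ⟨N, hN⟩ := (isUnit_one_sub_volterra A).exists_right_inv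
  have hN' : ∀ h, N h = h + volterra A (N h) := by
    intro h
    have := congrArg (fun T : (Fin n → Profile) →L[ℝ] (Fin n → Profile) => T h) hN
    simp only [sub_mul, one_mul, sub_apply, mul_apply_eq_comp] at this
    exact sub_eq_iff_eq_add.1 this
  -- The shooting map, from initial value to boundary defect, is an endomorphism of a
  -- finite-dimensional space. Injectivity therefore already gives invertibility, and a kernel
  -- vector gives a homogeneous solution.
  let S : P →L[ℝ] P := β.comp (N.comp ι)
  by_cases hS : Function.Injective S
  · right
    let e : P ≃L[ℝ] P :=
      (LinearEquiv.ofInjectiveEndo S.toLinearMap hS).toContinuousLinearEquiv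
    have he : ∀ c, e c = S c := fun c => rfl
    let G : (Fin n → Profile) →L[ℝ] P := (e.symm : P →L[ℝ] P).comp (β.comp N)
    -- The initial value `-G h` cancels the boundary defect of the particular solution `N h`.
    let Y : (Fin n → Profile) →L[ℝ] (Fin n → Profile) := N - N.comp (ι.comp G)
    have hY : ∀ h, Y h = N (ι (-G h) + h) := by
      intro h
      simp [Y, sub_eq_neg_add]
    refine ⟨‖Y‖, norm_nonneg Y, fun h => ⟨-G h, Y h, ?_, ?_, Y.le_opNorm h⟩⟩
    · rw [hY]
      conv_lhs => rw [hN']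
      abel
    · have h1 : β (N (ι (G h))) = β (N h) := by
        change S (G h) = _
        rw [← he]
        exact e.apply_symm_apply _
      rw [hY, map_add, map_add, map_neg, map_neg, map_neg, h1, neg_add_cancel]
  · left
    rw [← ContinuousLinearMap.coe_coe, ← LinearMap.ker_eq_bot, ← ne_eq, Submodule.ne_bot_iff] at hS
    obtain ⟨c, hc, hc0⟩ := hS
    exact ⟨c, N (ι c), hc0, hN' _, hc⟩

end LinearSystem
end Convection

/-! ### The symmetric bilinear forms and the weak formulation. -/

namespace Convection
open Profile

/-- A viscosity profile with its first two derivatives, the Prandtl number and the wavenumber. -/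
structure Medium where
  (visc visc' visc'' : Profile)
  isDeriv_visc : IsDeriv visc visc'
  isDeriv_visc' : IsDeriv visc' visc''
  visc_pos : ∀ z, 0 < visc z
  visc''_nonneg : 0 ≤ visc''
  (Pr k : ℝ)
  Pr_pos : 0 < Pr
  k_ne_zero : k ≠ 0

/-- The pairing `∫ w f g` of two profiles. -/
noncomputable def weightedInner (w : Profile) : LinearMap.BilinForm ℝ Profile :=
  LinearMap.mk₂ ℝ (fun f g => integral (w * f * g))
    (fun f f' g => by rw [← map_add]; congr 1; ring)
    (fun c f g => by rw [← map_smul]; congr 1; ext; simp)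
    (fun f g g' => by rw [← map_add]; congr 1; ring)
    (fun c f g => by rw [← map_smul]; congr 1; ext; simp)

/-- A perturbation, given by the second derivative of its vertical velocity and the first
derivative of its temperature. -/
abbrev Perturbation := Profile × Profile

/-- The derivative of the vertical velocity. -/
noncomputable def slope : Perturbation →ₗ[ℝ] Profile :=
  primitive.toLinearMap ∘ₗ LinearMap.fst ℝ Profile Profile

/-- The vertical velocity. -/
noncomputable def velocity : Perturbation →ₗ[ℝ] Profile := primitive.toLinearMap ∘ₗ slope

/-- The (rescaled) temperature. -/
noncomputable def temperature : Perturbation →ₗ[ℝ] Profile :=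
  primitive.toLinearMap ∘ₗ LinearMap.snd ℝ Profile Profile

theorem isDeriv_velocity (u : Perturbation) : IsDeriv (velocity u) (slope u) :=
  isDeriv_primitive _

theorem isDeriv_slope (u : Perturbation) : IsDeriv (slope u) u.1 := isDeriv_primitive _

theorem isDeriv_temperature (u : Perturbation) : IsDeriv (temperature u) u.2 :=
  isDeriv_primitive _

@[simp] theorem velocity_bottom (u : Perturbation) : velocity u bottomPlate = 0 :=
  primitive_bottom _

@[simp] theorem slope_bottom (u : Perturbation) : slope u bottomPlate = 0 :=
  primitive_bottom _

@[simp] theorem temperature_bottom (u : Perturbation) : temperature u bottomPlate = 0 :=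
  primitive_bottom _

/-- The perturbations whose velocity and temperature vanish at the top plate. -/
noncomputable def admissible : Submodule ℝ Perturbation where
  carrier := {u | velocity u topPlate = 0 ∧ temperature u topPlate = 0}
  zero_mem' := by simp
  add_mem' := fun {u v} hu hv => by
    simp only [Set.mem_ofPred_eq, map_add, ContinuousMap.add_apply] at *
    simp [hu, hv]
  smul_mem' := fun c u hu => by
    simp only [Set.mem_ofPred_eq, map_smul, ContinuousMap.smul_apply] at *
    simp [hu]

theorem mem_admissible {u : Perturbation} :
    u ∈ admissible ↔ velocity u topPlate = 0 ∧ temperature u topPlate = 0 := Iff.rfl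

/-- Derivatives are unique, so the stored pair is recovered from velocity and temperature. This
makes `inertia` positive definite. -/
theorem velocity_ne_zero_or {u : Perturbation} (hu : u ≠ 0) :
    velocity u ≠ 0 ∨ temperature u ≠ 0 := by
  by_contra! h
  apply hu
  have h0 : IsDeriv 0 0 := isDeriv_const 0
  have h1 : slope u = 0 := (h.1 ▸ isDeriv_velocity u).unique h0
  have h2 : u.1 = 0 := (h1 ▸ isDeriv_slope u).unique h0
  have h3 : u.2 = 0 := (h.2 ▸ isDeriv_temperature u).unique h0
  exact Prod.ext h2 h3

namespace Medium

variable (S : Medium)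

/-- Viscous and thermal dissipation. -/
noncomputable def dissipation : LinearMap.BilinForm ℝ Perturbation :=
  (weightedInner S.visc).compl₁₂ (LinearMap.fst ℝ _ _) (LinearMap.fst ℝ _ _)
    + (weightedInner ((2 * S.k ^ 2) • S.visc)).compl₁₂ slope slope
    + (weightedInner (S.k ^ 4 • S.visc + S.k ^ 2 • S.visc'')).compl₁₂ velocity velocity
    + (weightedInner 1).compl₁₂ (LinearMap.snd ℝ _ _) (LinearMap.snd ℝ _ _)
    + (weightedInner (ContinuousMap.const _ (S.k ^ 2))).compl₁₂ temperature temperature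

/-- The quadratic form multiplying the growth rate. -/
noncomputable def inertia : LinearMap.BilinForm ℝ Perturbation :=
  (weightedInner (ContinuousMap.const _ (S.Pr⁻¹))).compl₁₂ slope slope
    + (weightedInner (ContinuousMap.const _ (S.Pr⁻¹ * S.k ^ 2))).compl₁₂ velocity velocity
    + (weightedInner 1).compl₁₂ temperature temperature

/-- Gathering the form into one integral reduces estimates and identities to pointwise ones in the
integrand. -/
theorem dissipation_apply (u v : Perturbation) : S.dissipation u v
    = integral (S.visc * u.1 * v.1 + (2 * S.k ^ 2) • S.visc * slope u * slope v
      + (S.k ^ 4 • S.visc + S.k ^ 2 • S.visc'') * velocity u * velocity v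
      + 1 * u.2 * v.2 + ContinuousMap.const _ (S.k ^ 2) * temperature u * temperature v) := by
  simp only [map_add]
  rfl

theorem inertia_apply (u v : Perturbation) : S.inertia u v
    = integral (ContinuousMap.const _ (S.Pr⁻¹) * slope u * slope v
      + ContinuousMap.const _ (S.Pr⁻¹ * S.k ^ 2) * velocity u * velocity v
      + 1 * temperature u * temperature v) := by
  simp only [map_add]
  rfl

end Medium

/-- The buoyancy coupling of velocity and temperature. -/
noncomputable def coupling : LinearMap.BilinForm ℝ Perturbation :=
  (weightedInner 1).compl₁₂ velocity temperature + (weightedInner 1).compl₁₂ temperature velocity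

theorem coupling_apply (u v : Perturbation) : coupling u v
    = integral (1 * velocity u * temperature v + 1 * temperature u * velocity v) := by
  simp only [map_add]
  rfl

theorem coupling_comm (u v : Perturbation) : coupling u v = coupling v u := by
  rw [coupling_apply, coupling_apply]; congr 1; ring

namespace Medium

variable (S : Medium)

theorem dissipation_comm (u v : Perturbation) : S.dissipation u v = S.dissipation v u := by
  rw [dissipation_apply, dissipation_apply]; congr 1; ring

theorem inertia_comm (u v : Perturbation) : S.inertia u v = S.inertia v u := by
  rw [inertia_apply, inertia_apply]; congr 1; ring

theorem inertia_nonneg (u : Perturbation) : 0 ≤ S.inertia u u := by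
  rw [inertia_apply]
  refine integral_nonneg fun z => ?_
  have := S.Pr_pos
  simp only [ContinuousMap.add_apply, ContinuousMap.mul_apply, ContinuousMap.const_apply,
    ContinuousMap.one_apply, mul_assoc]
  have h := mul_self_nonneg (slope u z)
  have h' := mul_self_nonneg (velocity u z)
  have h'' := mul_self_nonneg (temperature u z)
  positivity

theorem inertia_pos {u : Perturbation} {z : layer}
    (hz : velocity u z ≠ 0 ∨ temperature u z ≠ 0) : 0 < S.inertia u u := by
  have := S.Pr_pos
  have := S.k_ne_zero
  have key : ∀ z, 0 ≤ S.Pr⁻¹ * (slope u z * slope u z)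
      ∧ 0 ≤ S.Pr⁻¹ * S.k ^ 2 * (velocity u z * velocity u z)
      ∧ 0 ≤ temperature u z * temperature u z := by
    intro z
    have h := mul_self_nonneg (slope u z)
    have h' := mul_self_nonneg (velocity u z)
    refine ⟨by positivity, by positivity, mul_self_nonneg _⟩
  rw [inertia_apply]
  refine integral_pos (z := z) (fun z => ?_) ?_
  all_goals
    simp only [ContinuousMap.add_apply, ContinuousMap.mul_apply, ContinuousMap.const_apply,
      mul_assoc, one_mul]
    obtain ⟨h1, h2, h3⟩ := key z
    simp only [mul_assoc] at h1 h2 h3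
  · linarith
  · apply ne_of_gt
    rcases hz with hz | hz
    · have : 0 < S.Pr⁻¹ * (S.k ^ 2 * (velocity u z * velocity u z)) := by
        have := mul_self_pos.2 hz
        positivity
      linarith
    · linarith [mul_self_pos.2 hz]

theorem inertia_pos_of_ne_zero {u : Perturbation} (hu : u ≠ 0) : 0 < S.inertia u u := by
  rcases velocity_ne_zero_or hu with h | h
  · obtain ⟨z, hz⟩ := DFunLike.ne_iff.1 h
    exact S.inertia_pos (Or.inl hz)
  · obtain ⟨z, hz⟩ := DFunLike.ne_iff.1 h
    exact S.inertia_pos (Or.inr hz)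

theorem exists_visc_lower_bound : ∃ c : ℝ, 0 < c ∧ ∀ z, c ≤ S.visc z := by
  obtain ⟨z, -, hz⟩ := isCompact_univ.exists_isMinOn ⟨bottomPlate, Set.mem_univ _⟩
    S.visc.continuous.continuousOn
  exact ⟨S.visc z, S.visc_pos z, fun y => hz (Set.mem_univ y)⟩

/-- No Poincaré inequality is needed: since `k ≠ 0`, the lower-order terms of the dissipation
control the inertia pointwise. The sign of `ν''` is used for the velocity term. -/
theorem exists_inertia_le_dissipation :
    ∃ c : ℝ, 0 < c ∧ ∀ u, c * S.inertia u u ≤ S.dissipation u u := by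
  obtain ⟨ν₀, hν₀, hν⟩ := S.exists_visc_lower_bound
  have hPr := S.Pr_pos
  have hk : 0 < S.k ^ 2 := by have := S.k_ne_zero; positivity
  refine ⟨min (S.k ^ 2) (ν₀ * S.k ^ 2 * S.Pr), by positivity, fun u => ?_⟩
  set c := min (S.k ^ 2) (ν₀ * S.k ^ 2 * S.Pr)
  have hc0 : 0 < c := by positivity
  have hc1 : c ≤ S.k ^ 2 := min_le_left _ _
  have hc2 : c * S.Pr⁻¹ ≤ ν₀ * S.k ^ 2 := by
    rw [← div_eq_mul_inv, div_le_iff₀ hPr]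
    exact min_le_right _ _
  rw [inertia_apply, dissipation_apply, mul_integral]
  refine integral_mono fun z => ?_
  have hνz := hν z
  have hν'' : 0 ≤ S.visc'' z := S.visc''_nonneg z
  simp only [ContinuousMap.add_apply, ContinuousMap.mul_apply, ContinuousMap.const_apply,
      ContinuousMap.smul_apply, mul_assoc, one_mul, smul_eq_mul]
  have h1 := mul_self_nonneg (slope u z)
  have h2 := mul_self_nonneg (velocity u z)
  have h3 := mul_self_nonneg (temperature u z)
  have h4 := mul_self_nonneg (u.1 z)
  have h5 := mul_self_nonneg (u.2 z)
  generalize slope u z * slope u z = a at *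
  generalize velocity u z * velocity u z = b at *
  generalize temperature u z * temperature u z = t at *
  generalize u.1 z * u.1 z = p at *
  generalize u.2 z * u.2 z = q at *
  generalize S.visc z = n at *
  generalize S.visc'' z = n2 at *
  have e1 : c * (S.Pr⁻¹ * a) ≤ 2 * (S.k ^ 2 * (n * a)) := by
    calc c * (S.Pr⁻¹ * a) = c * S.Pr⁻¹ * a := by ring
      _ ≤ n * S.k ^ 2 * a := mul_le_mul_of_nonneg_right (hc2.trans (by gcongr)) h1
      _ ≤ _ := by nlinarith [mul_nonneg (mul_nonneg (hν₀.le.trans hνz) hk.le) h1]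
  have e2 : c * (S.Pr⁻¹ * (S.k ^ 2 * b)) ≤ (S.k ^ 4 * n + S.k ^ 2 * n2) * b := by
    calc c * (S.Pr⁻¹ * (S.k ^ 2 * b)) = c * S.Pr⁻¹ * (S.k ^ 2 * b) := by ring
      _ ≤ n * S.k ^ 2 * (S.k ^ 2 * b) :=
        mul_le_mul_of_nonneg_right (hc2.trans (by gcongr)) (by positivity)
      _ ≤ _ := by nlinarith [mul_nonneg (mul_nonneg hν'' hk.le) h2]
  have e3 : c * t ≤ S.k ^ 2 * t := by gcongr
  have e4 : 0 ≤ n * p := mul_nonneg (hν₀.le.trans hνz) h4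
  linarith

/-- Pointwise `2|WΘ| ≤ W² + Θ²`; the constant compensates the weight `k²/Pr` of `W²` in the inertia.
-/
theorem exists_abs_coupling_le :
    ∃ C : ℝ, 0 < C ∧ ∀ u, |coupling u u| ≤ C * S.inertia u u := by
  have hPr := S.Pr_pos
  have hk0 := S.k_ne_zero
  have hk : 0 < S.k ^ 2 := by positivity
  refine ⟨max (S.Pr / S.k ^ 2) 1, by positivity, fun u => ?_⟩
  set C := max (S.Pr / S.k ^ 2) 1
  have hC0 : 0 < C := by positivity
  have hC1 : 1 ≤ C := le_max_right _ _
  have hC2 : 1 ≤ C * (S.Pr⁻¹ * S.k ^ 2) := by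
    have : S.Pr / S.k ^ 2 ≤ C := le_max_left _ _
    calc 1 = S.Pr / S.k ^ 2 * (S.Pr⁻¹ * S.k ^ 2) := by field_simp
      _ ≤ _ := by gcongr
  have key : ∀ z, 0 ≤ C * (S.Pr⁻¹ * (slope u z * slope u z)) ∧
      velocity u z * velocity u z
        ≤ C * (S.Pr⁻¹ * (S.k ^ 2 * (velocity u z * velocity u z))) ∧
      temperature u z * temperature u z ≤ C * (temperature u z * temperature u z) := by
    intro z
    have h1 := mul_self_nonneg (slope u z)
    have h2 := mul_self_nonneg (velocity u z)
    have h3 := mul_self_nonneg (temperature u z)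
    refine ⟨by positivity, ?_, ?_⟩
    · calc _ = 1 * (velocity u z * velocity u z) := by ring
        _ ≤ C * (S.Pr⁻¹ * S.k ^ 2) * (velocity u z * velocity u z) := by gcongr
        _ = _ := by ring
    · nlinarith
  rw [inertia_apply, coupling_apply, mul_integral, abs_le, ← map_neg integral]
  constructor <;> refine integral_mono fun z => ?_
  all_goals
    simp only [ContinuousMap.add_apply, ContinuousMap.mul_apply, ContinuousMap.const_apply,
      ContinuousMap.smul_apply, ContinuousMap.neg_apply, mul_assoc,
      one_mul, smul_eq_mul]
    obtain ⟨h1, h2, h3⟩ := key z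
    nlinarith [sq_nonneg (velocity u z + temperature u z),
      sq_nonneg (velocity u z - temperature u z)]

/-- A one-dimensional Sobolev bound: `slope` and `temperature` are primitives, so their sup norms
are bounded by the `L²` norms of `W''` and `Θ'`, which the dissipation contains. -/
theorem exists_sq_norm_le_dissipation : ∃ C : ℝ, 0 ≤ C ∧ ∀ u,
    ‖slope u‖ ^ 2 ≤ C * S.dissipation u u ∧ ‖temperature u‖ ^ 2 ≤ C * S.dissipation u u := by
  obtain ⟨ν₀, hν₀, hν⟩ := S.exists_visc_lower_bound
  have hsq : ∀ f : Profile, ‖primitive f‖ ^ 2 ≤ integral (f * f) := by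
    intro f
    obtain ⟨z, hz⟩ : ∃ z, ‖primitive f‖ = ‖primitive f z‖ := by
      obtain ⟨z, -, hz⟩ := isCompact_univ.exists_isMaxOn ⟨bottomPlate, Set.mem_univ _⟩
        (primitive f).continuous.norm.continuousOn
      exact ⟨z, le_antisymm ((ContinuousMap.norm_le _ (norm_nonneg _)).2
        fun y => hz (Set.mem_univ y)) ((primitive f).norm_coe_le_norm z)⟩
    rw [hz, Real.norm_eq_abs, sq_abs]
    exact sq_primitive_le f z
  have key : ∀ u : Perturbation, integral (u.2 * u.2) ≤ S.dissipation u u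
      ∧ ν₀ * integral (u.1 * u.1) ≤ S.dissipation u u := by
    intro u
    rw [dissipation_apply, mul_integral]
    constructor <;> refine integral_mono fun z => ?_
    all_goals
      simp only [ContinuousMap.add_apply, ContinuousMap.mul_apply, ContinuousMap.const_apply,
        ContinuousMap.smul_apply, mul_assoc, one_mul, smul_eq_mul]
      have h0 := hν z
      have h0' : 0 ≤ S.visc z := hν₀.le.trans h0
      have h0'' : 0 ≤ S.visc'' z := S.visc''_nonneg z
      have h1 := mul_self_nonneg (slope u z)
      have h2 := mul_self_nonneg (velocity u z)
      have h3 := mul_self_nonneg (temperature u z)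
      have h4 := mul_self_nonneg (u.1 z)
      have h5 := mul_self_nonneg (u.2 z)
      have e1 : 0 ≤ 2 * (S.k ^ 2 * (S.visc z * (slope u z * slope u z))) := by positivity
      have e2 : 0 ≤ (S.k ^ 4 * S.visc z + S.k ^ 2 * S.visc'' z)
        * (velocity u z * velocity u z) := by positivity
      have e3 : 0 ≤ S.k ^ 2 * (temperature u z * temperature u z) := by positivity
      have e4 : 0 ≤ S.visc z * (u.1 z * u.1 z) := by positivity
      have e5 : ν₀ * (u.1 z * u.1 z) ≤ S.visc z * (u.1 z * u.1 z) := by gcongr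
      linarith
  have hd : ∀ u, 0 ≤ S.dissipation u u := fun u =>
    (integral_nonneg (fun z => mul_self_nonneg (u.2 z))).trans (key u).1
  refine ⟨max ν₀⁻¹ 1, by positivity, fun u => ⟨?_, ?_⟩⟩
  · calc _ ≤ integral (u.1 * u.1) := hsq u.1
      _ = ν₀⁻¹ * (ν₀ * integral (u.1 * u.1)) := by field_simp
      _ ≤ max ν₀⁻¹ 1 * S.dissipation u u :=
        mul_le_mul (le_max_left _ _) (key u).2
          (mul_nonneg hν₀.le (integral_nonneg fun z => mul_self_nonneg (u.1 z))) (by positivity)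
  · calc _ ≤ integral (u.2 * u.2) := hsq u.2
      _ ≤ 1 * S.dissipation u u := by simpa using (key u).1
      _ ≤ _ := mul_le_mul_of_nonneg_right (le_max_right _ _) (hd u)

theorem exists_inertia_le_sq_norm : ∃ C : ℝ, 0 ≤ C ∧ ∀ u (M : ℝ), ‖velocity u‖ ≤ M →
    ‖slope u‖ ≤ M → ‖temperature u‖ ≤ M → S.inertia u u ≤ C * M ^ 2 := by
  have hPr := S.Pr_pos
  refine ⟨S.Pr⁻¹ + S.Pr⁻¹ * S.k ^ 2 + 1, by positivity, fun u M h1 h2 h3 => ?_⟩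
  rw [inertia_apply]
  refine (le_abs_self _).trans ((abs_integral_le _).trans ?_)
  have hsq : ∀ {x : ℝ}, ‖x‖ ≤ M → 0 ≤ x * x ∧ x * x ≤ M ^ 2 := fun {x} hx =>
    ⟨mul_self_nonneg x, by rw [← sq, sq_le_sq]; exact hx.trans (le_abs_self M)⟩
  rw [ContinuousMap.norm_le _ (by positivity)]
  intro z
  have h1' := hsq (((velocity u).norm_coe_le_norm z).trans h1)
  have h2' := hsq (((slope u).norm_coe_le_norm z).trans h2)
  have h3' := hsq (((temperature u).norm_coe_le_norm z).trans h3)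
  simp only [ContinuousMap.add_apply, ContinuousMap.mul_apply, ContinuousMap.const_apply,
      mul_assoc, one_mul]
  rw [Real.norm_of_nonneg]
  · calc _ ≤ S.Pr⁻¹ * M ^ 2 + S.Pr⁻¹ * (S.k ^ 2 * M ^ 2) + M ^ 2 := by
          gcongr
          exacts [h2'.2, h1'.2, h3'.2]
      _ = _ := by ring
  · have := h1'.1
    have := h2'.1
    have := h3'.1
    positivity

/-- `u` solves the boundary value problem for the operator with growth rate `σ` and buoyancy
parameter `r`, with the inertia of `η` on the right-hand side. -/
structure IsSolution (r σ : ℝ) (u η : Perturbation) : Prop where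
  mem : u ∈ admissible
  stress_top : (S.visc * u.1) topPlate = 0
  momentum : ∃ X₁ X₂ : Profile, IsDeriv (S.visc * u.1) X₁ ∧ IsDeriv X₁ X₂ ∧
    X₂ = (2 * S.k ^ 2) • (S.visc' * slope u + S.visc * u.1)
      - (S.k ^ 4 • S.visc + S.k ^ 2 • S.visc'') * velocity u + r • temperature u
      - (σ / S.Pr) • (S.k ^ 2 • velocity u - u.1) + S.Pr⁻¹ • (S.k ^ 2 • velocity η - η.1)
  heat : IsDeriv u.2 ((S.k ^ 2 + σ) • temperature u - r • velocity u - temperature η)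

variable {S}

/-- Integration by parts against `w`. The boundary terms vanish because of the conditions on `w` at
both plates and the vanishing stress of `u` at the top, where `slope w` is free. -/
theorem IsSolution.weak {r σ : ℝ} {u η w : Perturbation} (h : S.IsSolution r σ u η)
    (hw : w ∈ admissible) :
    S.dissipation w u - r * coupling w u + σ * S.inertia w u = S.inertia w η := by
  obtain ⟨X₁, X₂, hX₁, hX₂, hX⟩ := h.momentum
  -- All integrations by parts at once: the derivative of this function is the integrand of the left
  -- side minus that of the right side.
  have hd : IsDeriv (S.visc * u.1 * slope w - X₁ * velocity w
      + (2 * S.k ^ 2) • (S.visc * slope u * velocity w) + u.2 * temperature w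
      + (σ / S.Pr) • (slope u * velocity w) - S.Pr⁻¹ • (slope η * velocity w)) _ :=
    (((((hX₁.mul (isDeriv_slope w)).sub (hX₂.mul (isDeriv_velocity w))).add
      (((S.isDeriv_visc.mul (isDeriv_slope u)).mul (isDeriv_velocity w)).smul _)).add
      (h.heat.mul (isDeriv_temperature w))).add
      (((isDeriv_slope u).mul (isDeriv_velocity w)).smul _)).sub
      (((isDeriv_slope η).mul (isDeriv_velocity w)).smul _)
  have hi := hd.integral
  rw [hX] at hi
  obtain ⟨hw1, hw2⟩ := mem_admissible.1 hw
  have hst : S.visc topPlate * u.1 topPlate = 0 := h.stress_top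
  simp only [ContinuousMap.add_apply, ContinuousMap.mul_apply, ContinuousMap.sub_apply,
    ContinuousMap.smul_apply, hw1, hw2, velocity_bottom, slope_bottom, temperature_bottom,
    mul_zero, smul_zero, hst, zero_mul, add_zero, sub_zero] at hi
  rw [← sub_eq_zero, ← hi, dissipation_apply, coupling_apply, inertia_apply, inertia_apply,
    mul_integral, mul_integral, ← map_sub integral, ← map_add integral, ← map_sub integral]
  congr 1
  ext z
  simp only [ContinuousMap.add_apply, ContinuousMap.mul_apply, ContinuousMap.const_apply,
    ContinuousMap.one_apply, ContinuousMap.smul_apply, ContinuousMap.sub_apply, smul_eq_mul]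
  ring

end Medium
end Convection

/-! ### The Rayleigh quotient as a convex function of the buoyancy parameter. -/

namespace Convection
open Profile
namespace Medium

variable (S : Medium)

/-- The growth rates that dominate the Rayleigh quotient for the buoyancy parameter `r`. -/
def dominating (r : ℝ) : Set ℝ :=
  {σ | ∀ u ∈ admissible, r * coupling u u - S.dissipation u u ≤ σ * S.inertia u u}

/-- The maximum of the Rayleigh quotient for the buoyancy parameter `r`. -/
noncomputable def growth (r : ℝ) : ℝ := sInf (S.dominating r)

/-- An admissible perturbation whose velocity and temperature are positive inside the layer. -/
theorem exists_coupling_pos : ∃ u ∈ admissible, u ≠ 0 ∧ 0 < coupling u u := by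
  let z : Profile := ⟨fun z => z + 1 / 2, by fun_prop⟩
  have hz : IsDeriv z 1 := by
    intro x hx
    have h1 : HasDerivWithinAt (fun y : ℝ => y + 1 / 2) 1 layer x :=
      (hasDerivWithinAt_id x layer).add_const _
    refine h1.congr (fun y hy => ?_) ?_
    · rw [ext_of_mem _ hy]; rfl
    · rw [ext_of_mem _ hx]; rfl
  have h0 : z bottomPlate = 0 := by
    change (-(1 / 2) : ℝ) + 1 / 2 = 0
    norm_num
  have h1 : z topPlate = 1 := by
    change (1 / 2 : ℝ) + 1 / 2 = 1
    norm_num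
  -- With `z` running over `[0, 1]`, these are the derivatives belonging to the velocity `z²(1 -
  -- z)(3 - 2z)` and the temperature `z(1 - z)`.
  let u : Perturbation :=
    ((6 : ℝ) • (1 : Profile) - (30 : ℝ) • z + (24 : ℝ) • (z * z), (1 : Profile) - (2 : ℝ) • z)
  have hT : temperature u = z - z * z := by
    refine (IsDeriv.eq_primitive ?_ (by simp [h0])).symm
    convert hz.sub (hz.mul hz) using 1
    simp only [u]
    ext; simp; ring
  have hs : slope u = (6 : ℝ) • z - (15 : ℝ) • (z * z) + (8 : ℝ) • (z * z * z) := by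
    refine (IsDeriv.eq_primitive ?_ (by simp [h0])).symm
    convert ((hz.smul 6).sub ((hz.mul hz).smul 15)).add (((hz.mul hz).mul hz).smul 8) using 1
    simp only [u]
    ext; simp; ring
  have hv : velocity u = (3 : ℝ) • (z * z) - (5 : ℝ) • (z * z * z)
      + (2 : ℝ) • (z * z * z * z) := by
    change primitive (slope u) = _
    refine (IsDeriv.eq_primitive ?_ (by simp [h0])).symm
    convert (((hz.mul hz).smul 3).sub (((hz.mul hz).mul hz).smul 5)).add
      ((((hz.mul hz).mul hz).mul hz).smul 2) using 1
    rw [hs]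
    ext; simp; ring
  have hpos : 0 < coupling u u := by
    have key : ∀ y, (1 * velocity u * temperature u + 1 * temperature u * velocity u) y
        = 2 * (z y) ^ 3 * (1 - z y) ^ 2 * (3 - 2 * z y) := by
      intro y
      rw [hv, hT]
      simp
      ring
    rw [coupling_apply]
    refine integral_pos (z := ⟨0, by norm_num, by norm_num⟩) (fun y => ?_) ?_
    · have h2 : 0 ≤ z y := by change 0 ≤ (y : ℝ) + 1 / 2; linarith [y.2.1]
      have h3 : z y ≤ 1 := by change (y : ℝ) + 1 / 2 ≤ 1; linarith [y.2.2]
      have h4 : 0 ≤ 3 - 2 * z y := by linarith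
      rw [key]
      positivity
    · rw [key]
      change 2 * ((0 : ℝ) + 1 / 2) ^ 3 * (1 - ((0 : ℝ) + 1 / 2)) ^ 2 * (3 - 2 * ((0 : ℝ) + 1 / 2)) ≠ 0
      norm_num
  refine ⟨u, ⟨?_, ?_⟩, fun h => ?_, hpos⟩
  · rw [hv]; simp [h1]; norm_num
  · rw [hT]; simp [h1]
  · rw [h] at hpos
    simp at hpos

theorem dominating_nonempty (r : ℝ) : (S.dominating r).Nonempty := by
  obtain ⟨C, -, hC⟩ := S.exists_abs_coupling_le
  obtain ⟨c, hc, hc'⟩ := S.exists_inertia_le_dissipation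
  refine ⟨|r| * C, fun u _ => ?_⟩
  have h1 : r * coupling u u ≤ |r| * (C * S.inertia u u) :=
    (le_abs_self _).trans (by rw [abs_mul]; gcongr; exact hC u)
  have h2 := (mul_nonneg hc.le (S.inertia_nonneg u)).trans (hc' u)
  linarith

theorem quotient_le_of_mem_dominating {r σ : ℝ} (hσ : σ ∈ S.dominating r) {u : Perturbation}
    (hu : u ∈ admissible) (h0 : u ≠ 0) :
    (r * coupling u u - S.dissipation u u) / S.inertia u u ≤ σ :=
  (div_le_iff₀ (S.inertia_pos_of_ne_zero h0)).2 (hσ u hu)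

theorem bddBelow_dominating (r : ℝ) : BddBelow (S.dominating r) := by
  obtain ⟨u, hu, h0, -⟩ := exists_coupling_pos
  exact ⟨_, fun σ hσ => S.quotient_le_of_mem_dominating hσ hu h0⟩

theorem growth_mem (r : ℝ) : S.growth r ∈ S.dominating r := by
  have hcl : IsClosed (S.dominating r) := by
    have : S.dominating r = ⋂ u ∈ admissible,
        {σ | r * coupling u u - S.dissipation u u ≤ σ * S.inertia u u} := by
      ext; simp [dominating]
    rw [this]
    exact isClosed_biInter fun u _ => isClosed_le continuous_const (by fun_prop)
  exact hcl.csInf_mem (S.dominating_nonempty r) (S.bddBelow_dominating r)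

theorem growth_le {r σ : ℝ} (h : σ ∈ S.dominating r) : S.growth r ≤ σ :=
  csInf_le (S.bddBelow_dominating r) h

/-- For each fixed `u` the inequality defining `dominating` is affine in `(r, σ)`, so a convex
combination of dominating values dominates at the combined parameter. -/
theorem convexOn_growth : ConvexOn ℝ Set.univ S.growth := by
  refine ⟨convex_univ, fun x _ y _ a b ha hb _ => S.growth_le fun u hu => ?_⟩
  have hx := mul_le_mul_of_nonneg_left (S.growth_mem x u hu) ha
  have hy := mul_le_mul_of_nonneg_left (S.growth_mem y u hu) hb
  simp only [smul_eq_mul]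
  have hab : a + b = 1 := by assumption
  have : S.dissipation u u = a * S.dissipation u u + b * S.dissipation u u := by
    rw [← add_mul, hab, one_mul]
  nlinarith

theorem continuous_growth : Continuous S.growth :=
  continuousOn_univ.1 (S.convexOn_growth.continuousOn isOpen_univ)

/-- Without buoyancy only dissipation remains, and it is coercive relative to the inertia. -/
theorem growth_zero_neg : S.growth 0 < 0 := by
  obtain ⟨c, hc, hc'⟩ := S.exists_inertia_le_dissipation
  have : S.growth 0 ≤ -c := S.growth_le fun u _ => by linarith [hc' u]
  linarith

theorem exists_growth_pos : ∃ r, 0 < r ∧ 0 < S.growth r := by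
  obtain ⟨u, hu, h0, hpos⟩ := exists_coupling_pos
  obtain ⟨r, hr⟩ := exists_gt (max 0 (S.dissipation u u / coupling u u))
  refine ⟨r, (le_max_left _ _).trans_lt hr, lt_of_lt_of_le ?_
    (S.quotient_le_of_mem_dominating (S.growth_mem r) hu h0)⟩
  have := (div_lt_iff₀ hpos).1 ((le_max_right _ _).trans_lt hr)
  exact div_pos (by linarith) (S.inertia_pos_of_ne_zero h0)

/-- The growth rate changes sign exactly once. -/
theorem exists_critical : ∃ r₀, 0 < r₀ ∧ S.growth r₀ = 0 ∧
    (∀ r, 0 < r → r < r₀ → S.growth r < 0) ∧ ∀ r, r₀ < r → 0 < S.growth r := by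
  obtain ⟨R, hR, hgR⟩ := S.exists_growth_pos
  obtain ⟨r₀, hr₀, h0⟩ := intermediate_value_Icc hR.le S.continuous_growth.continuousOn
    ⟨S.growth_zero_neg.le, hgR.le⟩
  have hne : 0 ≠ r₀ := by
    rintro rfl
    exact S.growth_zero_neg.ne h0
  have hr₀' : 0 < r₀ := lt_of_le_of_ne hr₀.1 hne
  refine ⟨r₀, hr₀', h0, fun r hr hr' => ?_, fun r hr => ?_⟩
  -- Here `r` lies between `0`, where `growth` is negative, and its zero `r₀`; the chord is negative
  -- at `r`.
  · have h := S.convexOn_growth.2 (Set.mem_univ 0) (Set.mem_univ r₀)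
      (sub_nonneg.2 (div_le_one_of_le₀ hr'.le hr₀'.le)) (by positivity : 0 ≤ r / r₀) (by ring)
    have h1 : 0 < 1 - r / r₀ := sub_pos.2 ((div_lt_one hr₀').2 hr')
    simp only [smul_eq_mul, mul_zero, zero_add, h0, add_zero, div_mul_cancel₀ r hr₀'.ne'] at h
    exact h.trans_lt (mul_neg_of_pos_of_neg h1 S.growth_zero_neg)
  · have hr0 : 0 < r := hr₀'.trans hr
    -- Now `r₀` lies between `0` and `r`: the chord must be nonnegative at `r₀` although it starts
    -- negative, so it ends positive.
    have h := S.convexOn_growth.2 (Set.mem_univ 0) (Set.mem_univ r)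
      (sub_nonneg.2 (div_le_one_of_le₀ hr.le hr0.le)) (by positivity : 0 ≤ r₀ / r) (by ring)
    have h1 : 0 < 1 - r₀ / r := sub_pos.2 ((div_lt_one hr0).2 hr)
    simp only [smul_eq_mul, mul_zero, zero_add, div_mul_cancel₀ r₀ hr0.ne', h0] at h
    have h2 := mul_neg_of_pos_of_neg h1 S.growth_zero_neg
    exact pos_of_mul_pos_right (by linarith : 0 < r₀ / r * S.growth r) (by positivity)

/-! ### Attainment of the maximum through the first-order system. -/

/-- The reciprocal viscosity. -/
noncomputable def fluidity : Profile :=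
  ⟨fun z => (S.visc z)⁻¹, S.visc.continuous.inv₀ fun z => (S.visc_pos z).ne'⟩

theorem visc_mul_fluidity (f : Profile) : S.visc * (S.fluidity * f) = f := by
  ext z
  exact mul_inv_cancel_left₀ (S.visc_pos z).ne' _

/-- The coefficients of the first-order system for the velocity, its derivative, the stress and its
derivative, the temperature and its derivative. -/
noncomputable def system (r σ : ℝ) : Fin 6 → Fin 6 → Profile :=
  ![![0, 1, 0, 0, 0, 0],
    ![0, 0, S.fluidity, 0, 0, 0],
    ![0, 0, 0, 1, 0, 0],
    ![-(S.k ^ 4 • S.visc + S.k ^ 2 • S.visc'' + (σ / S.Pr * S.k ^ 2) • 1),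
      (2 * S.k ^ 2) • S.visc', (2 * S.k ^ 2) • 1 + (σ / S.Pr) • S.fluidity, 0, r • 1, 0],
    ![0, 0, 0, 0, 0, 1],
    ![-(r • 1), 0, 0, 0, (S.k ^ 2 + σ) • 1, 0]]

/-- The free initial values at the bottom plate. -/
noncomputable def initialValue : (Fin 3 → ℝ) →L[ℝ] (Fin 6 → Profile) :=
  LinearMap.toContinuousLinearMap
    { toFun := fun c => ![0, 0, ContinuousMap.const _ (c 0), ContinuousMap.const _ (c 1), 0,
        ContinuousMap.const _ (c 2)]
      map_add' := fun c d => by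
        ext i z
        fin_cases i <;> simp
      map_smul' := fun a c => by
        ext i z
        fin_cases i <;> simp }

theorem initialValue_apply (c : Fin 3 → ℝ) : initialValue c = ![0, 0, ContinuousMap.const _ (c 0),
    ContinuousMap.const _ (c 1), 0, ContinuousMap.const _ (c 2)] := rfl

/-- The conditions at the top plate. -/
noncomputable def topValue : (Fin 6 → Profile) →L[ℝ] (Fin 3 → ℝ) :=
  ContinuousLinearMap.pi fun i =>
    (ContinuousMap.evalCLM ℝ topPlate).comp (ContinuousLinearMap.proj (![0, 2, 4] i))

/-- The inhomogeneity of the first-order system. -/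
noncomputable def source (η : Perturbation) : Fin 6 → Profile :=
  ![0, 0, 0, S.Pr⁻¹ • (S.k ^ 2 • primitive (velocity η) - slope η), 0, -primitive (temperature η)]

/-- The source enters the Volterra equation already integrated, so `η''` appears only through `slope
η`. Hence only sup norms controlled by the dissipation of `η` are needed. -/
theorem exists_norm_source_le :
    ∃ C : ℝ, 0 ≤ C ∧ ∀ η (M : ℝ), ‖slope η‖ ≤ M → ‖temperature η‖ ≤ M → ‖S.source η‖ ≤ C * M := by
  have hPr := S.Pr_pos
  refine ⟨max (S.Pr⁻¹ * (S.k ^ 2 + 1)) 1, by positivity, fun η M h1 h2 => ?_⟩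
  have hM : 0 ≤ M := (norm_nonneg _).trans h1
  have h3 : ‖primitive (velocity η)‖ ≤ M :=
    (abs_primitive_le _).trans ((abs_primitive_le _).trans h1)
  have h4 : ‖primitive (temperature η)‖ ≤ M := (abs_primitive_le _).trans h2
  have e1 : ‖S.Pr⁻¹ • (S.k ^ 2 • primitive (velocity η) - slope η)‖
      ≤ max (S.Pr⁻¹ * (S.k ^ 2 + 1)) 1 * M := by
    calc _ ≤ S.Pr⁻¹ * (S.k ^ 2 * M + M) := by
          rw [norm_smul, Real.norm_of_nonneg (by positivity)]
          gcongr
          refine (norm_sub_le _ _).trans ?_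
          rw [norm_smul, Real.norm_of_nonneg (by positivity)]
          gcongr
      _ = S.Pr⁻¹ * (S.k ^ 2 + 1) * M := by ring
      _ ≤ _ := by gcongr; exact le_max_left _ _
  have e2 : ‖-primitive (temperature η)‖ ≤ max (S.Pr⁻¹ * (S.k ^ 2 + 1)) 1 * M := by
    rw [norm_neg]
    exact h4.trans (le_mul_of_one_le_left hM (le_max_right _ _))
  have e0 : 0 ≤ max (S.Pr⁻¹ * (S.k ^ 2 + 1)) 1 * M := by positivity
  rw [pi_norm_le_iff_of_nonneg e0]
  intro i
  fin_cases i
  · simpa [source] using e0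
  · simpa [source] using e0
  · simpa [source] using e0
  · exact e1
  · simpa [source] using e0
  · exact e2

variable {S}

/-- A solution of the first-order boundary value problem yields a solution of the boundary value
problem. -/
theorem isSolution_of_system {r σ : ℝ} {η : Perturbation} {c : Fin 3 → ℝ} {y : Fin 6 → Profile}
    (hy : y = initialValue c + volterra (S.system r σ) y + S.source η) (htop : topValue y = 0) :
    S.IsSolution r σ (S.fluidity * y 2, y 5) η ∧ velocity (S.fluidity * y 2, y 5) = y 0 ∧
      slope (S.fluidity * y 2, y 5) = y 1 ∧ temperature (S.fluidity * y 2, y 5) = y 4 := by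
  set u : Perturbation := (S.fluidity * y 2, y 5)
  have h (i) : y i = initialValue c i + primitive (∑ j, S.system r σ i j * y j) + S.source η i := by
    conv_lhs => rw [hy]
    rw [Pi.add_apply, Pi.add_apply, volterra_apply]
  simp only [Fin.sum_univ_six] at h
  have h1 : slope u = y 1 := by
    rw [h 1]
    simp [system, source, initialValue_apply]
    rfl
  have h0 : velocity u = y 0 := by
    change primitive (slope u) = _
    rw [h 0, h1]
    simp [system, source, initialValue_apply]
  have h4 : temperature u = y 4 := by
    rw [h 4]
    simp [system, source, initialValue_apply]
    rfl
  have ht : ∀ i, y (![0, 2, 4] i) topPlate = 0 := fun i => congrFun htop i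
  have hu : S.visc * u.1 = y 2 := S.visc_mul_fluidity _
  refine ⟨⟨⟨?_, ?_⟩, ?_, ⟨y 3, _, ?_, ?_, rfl⟩, ?_⟩, h0, h1, h4⟩
  · rw [h0]; exact ht 0
  · rw [h4]; exact ht 2
  · rw [hu]; exact ht 1
  · rw [hu]
    refine isDeriv_of_eq_const_add (c := c 0) ?_
    conv_lhs => rw [h 2]
    simp [system, source, initialValue_apply]
  · refine isDeriv_of_eq_const_add (c := c 1) ?_
    conv_lhs => rw [h 3]
    -- The source component of the stress derivative is the primitive of the inertia of `η` in the
    -- momentum equation.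
    have e : primitive (S.Pr⁻¹ • (S.k ^ 2 • velocity η - η.1))
        = S.Pr⁻¹ • (S.k ^ 2 • primitive (velocity η) - slope η) := by
      rw [map_smul, map_sub, map_smul]
      rfl
    rw [map_add primitive _ (S.Pr⁻¹ • (S.k ^ 2 • velocity η - η.1)), e, ← add_assoc, hu, h1, h0, h4]
    change ContinuousMap.const _ (c 1) + _ + _ = _
    congr 2
    congr 1
    ext z
    simp [system, u]
    ring
  · refine isDeriv_of_eq_const_add (c := c 2) ?_
    conv_lhs => change y 5; rw [h 5]
    rw [map_sub, h0, h4, sub_eq_add_neg, ← add_assoc]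
    change ContinuousMap.const _ (c 2) + _ + _ = _
    congr 2
    congr 1
    ext z
    simp [system]
    ring

theorem system_solution_ne_zero {r σ : ℝ} {c : Fin 3 → ℝ} {y : Fin 6 → Profile} (hc : c ≠ 0)
    (hy : y = initialValue c + volterra (S.system r σ) y) : y ≠ 0 := by
  rintro rfl
  rw [map_zero, add_zero] at hy
  apply hc
  ext i
  fin_cases i
  · exact (DFunLike.congr_fun (congrFun hy 2) bottomPlate).symm
  · exact (DFunLike.congr_fun (congrFun hy 3) bottomPlate).symm
  · exact (DFunLike.congr_fun (congrFun hy 5) bottomPlate).symm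

variable (S)

/-- Either the homogeneous boundary value problem has a nontrivial solution, or the inhomogeneous
one is solvable with bounds. -/
theorem solution_alternative (r σ : ℝ) : (∃ u, u ≠ 0 ∧ S.IsSolution r σ u 0) ∨
    ∃ C : ℝ, 0 ≤ C ∧ ∀ η, ∃ u, S.IsSolution r σ u η ∧
      S.inertia u u ≤ C * S.dissipation η η := by
  rcases boundaryValue_alternative (S.system r σ) initialValue topValue with
    ⟨c, y, hc, hy, htop⟩ | ⟨C, hC, h⟩
  · left
    have hy' : y = initialValue c + volterra (S.system r σ) y + S.source 0 := by
      have : S.source 0 = 0 := by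
        ext i
        fin_cases i <;> simp [source]
      rw [this, add_zero]
      exact hy
    obtain ⟨hu, h0, h1, h4⟩ := isSolution_of_system hy' htop
    -- If the perturbation vanished, so would every component of `y`: the stress because it is `ν
    -- W''`, and `y 3` as the derivative of the stress.
    refine ⟨_, fun hu0 => system_solution_ne_zero hc hy ?_, hu⟩
    rw [hu0] at h0 h1 h4
    have h2 : y 2 = 0 := by
      rw [← S.visc_mul_fluidity (y 2), show S.fluidity * y 2 = 0 from congrArg Prod.fst hu0,
        mul_zero]
    have h3 : y 3 = 0 := by
      have e : y 2 = ContinuousMap.const _ (c 0) + primitive (y 3) := by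
        conv_lhs => rw [hy]
        rw [Pi.add_apply, volterra_apply, Fin.sum_univ_six]
        simp [system, initialValue_apply]
      exact (h2 ▸ isDeriv_of_eq_const_add e).unique (isDeriv_const 0)
    have h5 : y 5 = 0 := congrArg Prod.snd hu0
    ext i : 1
    fin_cases i
    exacts [h0.symm.trans (map_zero _), h1.symm.trans (map_zero _), h2, h3,
      h4.symm.trans (map_zero _), h5]
  · right
    obtain ⟨C₁, hC₁, h1⟩ := S.exists_sq_norm_le_dissipation
    obtain ⟨C₂, hC₂, h2⟩ := S.exists_inertia_le_sq_norm
    obtain ⟨C₃, hC₃, h3⟩ := S.exists_norm_source_le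
    refine ⟨C₂ * (C * C₃) ^ 2 * C₁, by positivity, fun η => ?_⟩
    obtain ⟨c, y, hy, htop, hbound⟩ := h (S.source η)
    obtain ⟨hu, e0, e1, e4⟩ := isSolution_of_system hy htop
    refine ⟨_, hu, ?_⟩
    set M := max ‖slope η‖ ‖temperature η‖
    have hM0 : 0 ≤ M := (norm_nonneg _).trans (le_max_left _ _)
    have hM : M ^ 2 ≤ C₁ * S.dissipation η η := by
      rcases max_choice ‖slope η‖ ‖temperature η‖ with hm | hm
      · simp only [M, hm]; exact (h1 η).1
      · simp only [M, hm]; exact (h1 η).2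
    have hyM : ‖y‖ ≤ C * C₃ * M := by
      rw [mul_assoc]
      exact hbound.trans (mul_le_mul_of_nonneg_left
        (h3 η M (le_max_left _ _) (le_max_right _ _)) hC)
    have hn (i) : ‖y i‖ ≤ C * C₃ * M := (norm_le_pi_norm y i).trans hyM
    calc _ ≤ C₂ * (C * C₃ * M) ^ 2 :=
          h2 _ _ (e0 ▸ hn 0) (e1 ▸ hn 1) (e4 ▸ hn 4)
      _ = C₂ * (C * C₃) ^ 2 * M ^ 2 := by ring
      _ ≤ C₂ * (C * C₃) ^ 2 * (C₁ * S.dissipation η η) := by gcongr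
      _ = _ := by ring

/-- The maximum of the Rayleigh quotient is an eigenvalue. -/
theorem exists_solution_growth (r : ℝ) : ∃ u, u ≠ 0 ∧ S.IsSolution r (S.growth r) u 0 := by
  refine (S.solution_alternative r (S.growth r)).resolve_right ?_
  rintro ⟨C, hC, h⟩
  set σ := S.growth r
  obtain ⟨C₁, hC₁, hc⟩ := S.exists_abs_coupling_le
  -- `B` is nonnegative on admissible perturbations because `growth r` dominates, so Cauchy-Schwarz
  -- applies to it. The aim is `B ≥ ε • inertia` with `ε > 0`, contradicting minimality.
  let B : LinearMap.BilinForm ℝ Perturbation := S.dissipation - r • coupling + σ • S.inertia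
  have hB (u v) : B u v = S.dissipation u v - r * coupling u v + σ * S.inertia u v := rfl
  let B' : LinearMap.BilinForm ℝ admissible := B.compl₁₂ admissible.subtype admissible.subtype
  have hB0 : ∀ u : admissible, 0 ≤ B' u u := by
    intro u
    change 0 ≤ B u u
    rw [hB]
    linarith [S.growth_mem r u u.2]
  have hBs : LinearMap.IsSymm B' := ⟨fun u v => by
    change B u v = B v u
    rw [hB, hB, S.dissipation_comm, coupling_comm, S.inertia_comm]⟩
  -- The factor of `C` bounds dissipation by inertia when `B u u < m`; the summand 1 ensures `K ≥
  -- 1`, so that `√K ≤ K` below.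
  set K := C * (1 + |r| * C₁ + |σ|) + 1
  have hK : 0 < K := by positivity
  have key : ∀ u ∈ admissible, min 1 K⁻¹ * S.inertia u u ≤ B u u := by
    intro u hu
    set m := S.inertia u u
    have hm : 0 ≤ m := S.inertia_nonneg u
    -- Otherwise `B u u < m`, and this upper bound is what controls the dissipation of `u`, hence
    -- the solution `v` with source `u`.
    by_cases hlt : m ≤ B u u
    · exact (mul_le_of_le_one_left hm (min_le_left _ _)).trans hlt
    push Not at hlt
    have hBu : 0 ≤ B u u := hB0 ⟨u, hu⟩
    have hmpos : 0 < m := hBu.trans_lt hlt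
    obtain ⟨v, hv, hvC⟩ := h u
    have hw : ∀ w ∈ admissible, B w v = S.inertia w u := fun w hw => hv.weak hw
    -- Since `B u v = m`, a bound `B v v ≤ K m` suffices. It comes from `B v v = inertia v u` and
    -- Cauchy-Schwarz for the inertia.
    have hcs : m ^ 2 ≤ B u u * B v v := by
      have := LinearMap.BilinForm.apply_sq_le_of_symm B' hB0 hBs ⟨u, hu⟩ ⟨v, hv.mem⟩
      change B u v ^ 2 ≤ B u u * B v v at this
      rwa [hw u hu] at this
    have hd : S.dissipation u u ≤ (1 + |r| * C₁ + |σ|) * m := by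
      have e1 : S.dissipation u u = B u u + r * coupling u u - σ * m := by rw [hB]; ring
      have e2 : r * coupling u u ≤ |r| * (C₁ * m) :=
        (le_abs_self _).trans (by rw [abs_mul]; gcongr; exact hc u)
      have e3 : -σ * m ≤ |σ| * m := by gcongr; exact neg_le_abs σ
      linarith
    have hvK : S.inertia v v ≤ K * m := by
      calc _ ≤ C * ((1 + |r| * C₁ + |σ|) * m) := hvC.trans (by gcongr)
        _ ≤ K * m := by
          rw [← mul_assoc]
          gcongr
          simp [K]
    have hvv : B v v ^ 2 ≤ K * m * m := by
      rw [hw v hv.mem]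
      exact (LinearMap.BilinForm.apply_sq_le_of_symm S.inertia S.inertia_nonneg
        ⟨S.inertia_comm⟩ v u).trans (by gcongr)
    have hK1 : 1 ≤ K := le_add_of_nonneg_left (by positivity)
    have hvv' : B v v ≤ K * m := by
      refine (le_abs_self _).trans (abs_le_of_sq_le_sq ?_ (by positivity))
      calc _ ≤ K * m * m := hvv
        _ ≤ K * (K * m * m) := le_mul_of_one_le_left (by positivity) hK1
        _ = _ := by ring
    have hmK : m ≤ K * B u u := by
      refine le_of_mul_le_mul_right ?_ hmpos
      calc m * m = m ^ 2 := by ring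
        _ ≤ B u u * B v v := hcs
        _ ≤ B u u * (K * m) := by gcongr
        _ = _ := by ring
    calc _ ≤ K⁻¹ * m := by gcongr; exact min_le_right _ _
      _ ≤ K⁻¹ * (K * B u u) := by gcongr
      _ = _ := by field_simp
  have hε : 0 < min 1 K⁻¹ := by positivity
  have : σ - min 1 K⁻¹ ∈ S.dominating r := by
    intro u hu
    have := key u hu
    rw [hB] at this
    linarith
  linarith [S.growth_le this]

end Medium
end Convection

/-! ### From complex normal modes to real solutions; reality of the eigenvalues. -/

namespace Convection
open Profile

section RealParts

/-- The profile `Re (a f)`. -/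
noncomputable def rePart (a : ℂ) (f : ℝ → ℂ) (hf : ContinuousOn f layer) : Profile :=
  ⟨fun z => (a * f z).re, Complex.continuous_re.comp
    (continuous_const.mul (continuousOn_iff_continuous_domRestrict.1 hf))⟩

@[simp] theorem rePart_apply {a : ℂ} {f : ℝ → ℂ} (hf : ContinuousOn f layer) (z : layer) :
    rePart a f hf z = (a * f z).re := rfl

theorem rePart_eq_zero {a : ℂ} {f : ℝ → ℂ} (hf : ContinuousOn f layer) {z : layer}
    (h : f z = 0) : rePart a f hf z = 0 := by simp [h]

theorem hasDerivWithinAt_D {f : ℝ → ℂ} {n : WithTop ℕ∞} (hf : ContDiffOn ℝ n f layer)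
    (hn : n ≠ 0) {z : ℝ} (hz : z ∈ layer) : HasDerivWithinAt f (D f z) layer z :=
  (hf.differentiableOn hn z hz).hasDerivWithinAt

theorem contDiffOn_D {f : ℝ → ℂ} {m n : WithTop ℕ∞} (hf : ContDiffOn ℝ n f layer)
    (h : m + 1 ≤ n) : ContDiffOn ℝ m (D f) layer := hf.derivWithin uniqueDiffOn_layer h

theorem isDeriv_rePart (a : ℂ) {f : ℝ → ℂ} (hf : ContinuousOn f layer)
    (hf' : ContinuousOn (D f) layer) (hd : DifferentiableOn ℝ f layer) :
    IsDeriv (rePart a f hf) (rePart a (D f) hf') := by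
  intro z hz
  have h := Complex.reCLM.hasFDerivAt.comp_hasDerivWithinAt z
    ((hd z hz).hasDerivWithinAt.const_mul a)
  rw [ext_of_mem _ hz]
  refine h.congr (fun y hy => ?_) ?_
  · rw [ext_of_mem _ hy]; rfl
  · rw [ext_of_mem _ hz]; rfl

end RealParts

/-- The medium with viscosity `ν`. -/
noncomputable def mediumOf (ν : ℝ → ℝ) (hν : ContDiffOn ℝ 2 ν layer)
    (hν_pos : ∀ z ∈ layer, 0 < ν z) (hν_convex : ConvexOn ℝ layer ν)
    (Pr : ℝ) (hPr : 0 < Pr) (k : ℝ) (hk : k ≠ 0) : Medium where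
  visc := ⟨layer.domRestrict ν, continuousOn_iff_continuous_domRestrict.1 hν.continuousOn⟩
  visc' := ⟨layer.domRestrict (dVisc ν), continuousOn_iff_continuous_domRestrict.1
    (hν.derivWithin uniqueDiffOn_layer (m := 1) (by norm_num)).continuousOn⟩
  visc'' := ⟨layer.domRestrict (derivWithin (dVisc ν) layer),
    continuousOn_iff_continuous_domRestrict.1 ((hν.derivWithin uniqueDiffOn_layer (m := 1)
      (by norm_num)).derivWithin uniqueDiffOn_layer (m := 0) (by norm_num)).continuousOn⟩
  isDeriv_visc := fun z hz => by
    rw [ext_of_mem _ hz]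
    refine (hν.differentiableOn (by norm_num) z hz).hasDerivWithinAt.congr (fun y hy => ?_) ?_
    · rw [ext_of_mem _ hy]; rfl
    · rw [ext_of_mem _ hz]; rfl
  isDeriv_visc' := fun z hz => by
    rw [ext_of_mem _ hz]
    refine ((hν.derivWithin uniqueDiffOn_layer (m := 1) (by norm_num)).differentiableOn
      (by norm_num) z hz).hasDerivWithinAt.congr (fun y hy => ?_) ?_
    · rw [ext_of_mem _ hy]; rfl
    · rw [ext_of_mem _ hz]; rfl
  visc_pos := fun z => hν_pos z z.2
  -- Convexity makes the first derivative monotone.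
  visc''_nonneg := fun _ =>
    (hν_convex.monotoneOn_derivWithin (hν.differentiableOn (by norm_num))).derivWithin_nonneg
  Pr := Pr
  k := k
  Pr_pos := hPr
  k_ne_zero := hk

/-- `S` is the medium with viscosity `ν`, Prandtl number `Pr` and wavenumber `k`. -/
structure Medium.Represents (S : Medium) (ν : ℝ → ℝ) (Pr k : ℝ) : Prop where
  contDiff : ContDiffOn ℝ 2 ν layer
  visc : ∀ z : layer, S.visc z = ν z
  visc' : ∀ z : layer, S.visc' z = dVisc ν z
  visc'' : ∀ z : layer, S.visc'' z = derivWithin (dVisc ν) layer z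
  Pr_eq : S.Pr = Pr
  k_eq : S.k = k

section NormalMode

variable {S : Medium} {ν : ℝ → ℝ} {Pr R k : ℝ} {σ : ℂ} {Z W Θ : ℝ → ℂ}

theorem contDiffOn_ofReal_visc (hν : ContDiffOn ℝ 2 ν layer) :
    ContDiffOn ℝ 2 (fun z => (ν z : ℂ)) layer :=
  Complex.ofRealCLM.contDiff.comp_contDiffOn hν

theorem hasDerivWithinAt_ofReal_visc (hν : ContDiffOn ℝ 2 ν layer) {z : ℝ} (hz : z ∈ layer) :
    HasDerivWithinAt (fun z => (ν z : ℂ)) (dVisc ν z : ℂ) layer z :=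
  (hν.differentiableOn (by norm_num) z hz).hasDerivWithinAt.ofReal_comp

theorem viscOp_eq (hν : ContDiffOn ℝ 2 ν layer) {f : ℝ → ℂ} (hf : ContDiffOn ℝ 2 f layer) {z : ℝ}
    (hz : z ∈ layer) : viscOp ν k f z
      = dVisc ν z * D f z + ν z * D (D f) z - (k : ℂ) ^ 2 * ν z * f z := by
  have h := (hasDerivWithinAt_ofReal_visc hν hz).mul
    (hasDerivWithinAt_D (contDiffOn_D (m := 1) hf (by norm_num)) one_ne_zero hz)
  have h' : D (fun y => (ν y : ℂ) * D f y) z = _ := h.derivWithin (uniqueDiffOn_layer z hz)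
  rw [viscOp, h']

/-- The leading term stays unexpanded: for `f = DW` it is the second derivative of the stress `ν
W''`, the quantity used in `IsSolution`. -/
theorem D_viscOp_eq (hν : ContDiffOn ℝ 2 ν layer) {f : ℝ → ℂ} (hf : ContDiffOn ℝ 3 f layer)
    {z : ℝ} (hz : z ∈ layer) : D (viscOp ν k f) z
      = D (D (fun y => (ν y : ℂ) * D f y)) z
        - (k : ℂ) ^ 2 * (dVisc ν z * f z + ν z * D f z) := by
  have hg : ContDiffOn ℝ 2 (fun y => (ν y : ℂ) * D f y) layer :=
    (contDiffOn_ofReal_visc hν).mul (contDiffOn_D hf (by norm_num))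
  have h := (hasDerivWithinAt_D (contDiffOn_D (m := 1) hg (by norm_num)) one_ne_zero hz).sub
    (((hasDerivWithinAt_ofReal_visc hν hz).mul
      (hasDerivWithinAt_D hf (by norm_num) hz)).const_mul ((k : ℂ) ^ 2))
  refine (h.congr (fun y _ => ?_) ?_).derivWithin (uniqueDiffOn_layer z hz)
  · simp [viscOp, mul_assoc]
  · simp [viscOp, mul_assoc]

theorem IsNormalMode.contDiff_DW (h : IsNormalMode ν Pr R k σ Z W Θ) :
    ContDiffOn ℝ 3 (D W) layer := contDiffOn_D h.contDiff_W (by norm_num)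

theorem IsNormalMode.contDiff_DDW (h : IsNormalMode ν Pr R k σ Z W Θ) :
    ContDiffOn ℝ 2 (D (D W)) layer := contDiffOn_D h.contDiff_DW (by norm_num)

theorem IsNormalMode.contDiff_DΘ (h : IsNormalMode ν Pr R k σ Z W Θ) :
    ContDiffOn ℝ 1 (D Θ) layer := contDiffOn_D h.contDiff_Θ (by norm_num)

/-- The real perturbation `Re (a W, a r Θ)` of a normal mode. -/
noncomputable def IsNormalMode.perturbation (h : IsNormalMode ν Pr R k σ Z W Θ) (r : ℝ) (a : ℂ) :
    Perturbation :=
  (rePart a (D (D W)) h.contDiff_DDW.continuousOn,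
    r • rePart a (D Θ) h.contDiff_DΘ.continuousOn)

theorem IsNormalMode.slope_perturbation (h : IsNormalMode ν Pr R k σ Z W Θ) (r : ℝ) (a : ℂ) :
    slope (h.perturbation r a) = rePart a (D W) h.contDiff_DW.continuousOn := by
  exact ((isDeriv_rePart a _ h.contDiff_DDW.continuousOn
    (h.contDiff_DW.differentiableOn (by norm_num))).eq_primitive
    (rePart_eq_zero _ h.bottom.2.2.1)).symm

theorem IsNormalMode.velocity_perturbation (h : IsNormalMode ν Pr R k σ Z W Θ) (r : ℝ) (a : ℂ) :
    velocity (h.perturbation r a) = rePart a W h.contDiff_W.continuousOn := by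
  change primitive (slope _) = _
  rw [h.slope_perturbation]
  exact ((isDeriv_rePart a _ _ (h.contDiff_W.differentiableOn (by norm_num))).eq_primitive
    (rePart_eq_zero _ h.bottom.2.1)).symm

theorem IsNormalMode.temperature_perturbation (h : IsNormalMode ν Pr R k σ Z W Θ) (r : ℝ)
    (a : ℂ) :
    temperature (h.perturbation r a) = r • rePart a Θ h.contDiff_Θ.continuousOn := by
  refine (((isDeriv_rePart a _ _ (h.contDiff_Θ.differentiableOn (by norm_num))).smul
    r).eq_primitive ?_).symm
  rw [ContinuousMap.smul_apply, rePart_eq_zero _ h.bottom.2.2.2, smul_zero]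

/-- Multiply by `a` and take real parts. As `Re(σaf) = Re σ · Re(af) + Im σ · Re(iaf)`, the
imaginary part of `σ` appears as a source given by the perturbation for `i a`. The choice of `r`
gives both buoyancy terms the same coefficient. -/
theorem IsNormalMode.isSolution (h : IsNormalMode ν Pr R k σ Z W Θ) (hS : S.Represents ν Pr k)
    {r : ℝ} (hr : r ^ 2 = R * k ^ 2) (a : ℂ) :
    S.IsSolution r σ.re (h.perturbation r a) (-σ.im • h.perturbation r (Complex.I * a)) := by
  have hν := hS.contDiff
  have hg : ContDiffOn ℝ 2 (fun y => (ν y : ℂ) * D (D W) y) layer :=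
    (contDiffOn_ofReal_visc hν).mul h.contDiff_DDW
  have hDg : ContDiffOn ℝ 1 (D fun y => (ν y : ℂ) * D (D W) y) layer :=
    contDiffOn_D hg (by norm_num)
  have hX : S.visc * (h.perturbation r a).1 = rePart a _ hg.continuousOn := by
    ext z
    simp [IsNormalMode.perturbation, hS.visc]
    ring
  refine ⟨⟨?_, ?_⟩, ?_, ⟨rePart a _ hDg.continuousOn, rePart a _
    (contDiffOn_D (m := 0) hDg (by norm_num)).continuousOn, ?_, ?_, ?_⟩, ?_⟩
  · rw [h.velocity_perturbation]
    exact rePart_eq_zero _ h.top.2.1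
  · rw [h.temperature_perturbation]
    rw [ContinuousMap.smul_apply, rePart_eq_zero _ h.top.2.2.2, smul_zero]
  · rw [hX]
    exact rePart_eq_zero _ (mul_eq_zero_of_right _ h.top.2.2.1)
  · rw [hX]
    exact isDeriv_rePart a _ _ (hg.differentiableOn (by norm_num))
  · exact isDeriv_rePart a _ _ (hDg.differentiableOn (by norm_num))
  · rw [map_smul, h.velocity_perturbation, h.velocity_perturbation, h.slope_perturbation,
      h.temperature_perturbation]
    ext z
    have hm := h.momentum z z.2
    rw [D_viscOp_eq hν h.contDiff_DW z.2,
      viscOp_eq hν (h.contDiff_W.of_le (by norm_num)) z.2] at hm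
    have hm' : D (D fun y => (ν y : ℂ) * D (D W) y) z
        = ((Pr⁻¹ : ℝ) : ℂ) * (σ * (D (D W) z - ((k ^ 2 : ℝ) : ℂ) * W z))
          + ((r ^ 2 : ℝ) : ℂ) * Θ z
          + ((2 * k ^ 2 : ℝ) : ℂ) * ((dVisc ν z : ℂ) * D W z + (ν z : ℂ) * D (D W) z)
          - ((k ^ 4 : ℝ) : ℂ) * ((ν z : ℂ) * W z)
          - ((k ^ 2 : ℝ) : ℂ) * (((derivWithin (dVisc ν) layer z : ℝ) : ℂ) * W z) := by
      rw [hr]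
      push_cast
      linear_combination -hm
    simp only [IsNormalMode.perturbation, rePart_apply, ContinuousMap.add_apply,
      ContinuousMap.sub_apply, ContinuousMap.mul_apply, ContinuousMap.smul_apply, smul_eq_mul,
      hS.visc, hS.visc', hS.visc'', hS.Pr_eq, hS.k_eq, Prod.smul_fst, hm', Complex.mul_re,
      Complex.mul_im, Complex.add_re, Complex.add_im, Complex.sub_re, Complex.sub_im,
      Complex.ofReal_re, Complex.ofReal_im, Complex.I_re, Complex.I_im]
    ring
  · have h1 : IsDeriv (h.perturbation r a).2 (r • rePart a (D (D Θ))
        (contDiffOn_D (m := 0) h.contDiff_DΘ (by norm_num)).continuousOn) :=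
      (isDeriv_rePart a _ _ (h.contDiff_DΘ.differentiableOn (by norm_num))).smul r
    convert h1 using 1
    rw [map_smul, h.velocity_perturbation, h.temperature_perturbation,
      h.temperature_perturbation]
    ext z
    have hh : D (D Θ) z = σ * Θ z + ((k ^ 2 : ℝ) : ℂ) * Θ z - W z := by
      push_cast
      linear_combination -h.heat z z.2
    simp only [rePart_apply, ContinuousMap.sub_apply, ContinuousMap.smul_apply, smul_eq_mul,
      hS.k_eq, hh, Complex.mul_re,
      Complex.mul_im, Complex.add_re, Complex.add_im, Complex.sub_re, Complex.sub_im,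
      Complex.ofReal_re, Complex.ofReal_im, Complex.I_re, Complex.I_im]
    ring

theorem re_ne_zero_or {w : ℂ} (hw : w ≠ 0) : (1 * w).re ≠ 0 ∨ (Complex.I * w).re ≠ 0 := by
  by_contra! h
  apply hw
  apply Complex.ext
  · simpa using h.1
  · simpa using h.2

/-- Convective eigenvalues are real and at most the maximum of the Rayleigh quotient. -/
theorem IsConvectiveEigenvalue.im_eq_zero_and_le (h : IsConvectiveEigenvalue ν Pr R k σ)
    (hS : S.Represents ν Pr k) {r : ℝ} (hr0 : 0 < r) (hr : r ^ 2 = R * k ^ 2) :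
    σ.im = 0 ∧ σ.re ≤ S.growth r := by
  obtain ⟨Z, W, Θ, h, z, hz, hne⟩ := h
  set u := h.perturbation r 1
  set v := h.perturbation r Complex.I
  have hu : S.IsSolution r σ.re u (-σ.im • v) := by
    simpa [u, v] using h.isSolution hS hr 1
  -- For `a = i` the source involves `i · i = -1`, which returns `u` with the opposite sign.
  have hv : S.IsSolution r σ.re v (σ.im • u) := by
    have hneg : h.perturbation r (-1) = -u := by
      refine Prod.ext ?_ ?_ <;> ext z <;> simp [IsNormalMode.perturbation, u]
    simpa [v, Complex.I_mul_I, hneg] using h.isSolution hS hr Complex.I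
  have hpos : 0 < S.inertia u u ∨ 0 < S.inertia v v := by
    rcases hne with hne | hne
    · refine (re_ne_zero_or hne).imp (fun h1 => S.inertia_pos (z := ⟨z, hz⟩) (Or.inl ?_))
        (fun h1 => S.inertia_pos (z := ⟨z, hz⟩) (Or.inl ?_))
      · rwa [h.velocity_perturbation]
      · rwa [h.velocity_perturbation]
    · refine (re_ne_zero_or hne).imp (fun h1 => S.inertia_pos (z := ⟨z, hz⟩) (Or.inr ?_))
        (fun h1 => S.inertia_pos (z := ⟨z, hz⟩) (Or.inr ?_))
      · rw [h.temperature_perturbation]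
        exact mul_ne_zero hr0.ne' h1
      · rw [h.temperature_perturbation]
        exact mul_ne_zero hr0.ne' h1
  have hu0 := S.inertia_nonneg u
  have hv0 := S.inertia_nonneg v
  have him : σ.im = 0 := by
    -- Each equation is tested with the other solution. By symmetry the left sides agree, leaving
    -- `Im σ · (m(u,u) + m(v,v)) = 0`.
    have h1 := hu.weak hv.mem
    have h2 := hv.weak hu.mem
    rw [map_smul, smul_eq_mul] at h1 h2
    rw [S.dissipation_comm, coupling_comm, S.inertia_comm] at h1
    have h3 : σ.im * (S.inertia u u + S.inertia v v) = 0 := by linarith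
    refine (mul_eq_zero.1 h3).resolve_right (ne_of_gt ?_)
    rcases hpos with hpos | hpos <;> linarith
  refine ⟨him, ?_⟩
  rw [him] at hu hv
  rcases hpos with hpos | hpos
  · have h1 := hu.weak hu.mem
    have h2 := S.growth_mem r u hu.mem
    simp only [neg_zero, zero_smul, map_zero] at h1
    exact le_of_mul_le_mul_right (by linarith) hpos
  · have h1 := hv.weak hv.mem
    have h2 := S.growth_mem r v hv.mem
    simp only [zero_smul, map_zero] at h1
    exact le_of_mul_le_mul_right (by linarith) hpos

/-- Eigenvalues of the decoupled vorticity equation are real and negative. -/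
theorem IsNormalMode.im_eq_zero_and_neg_of_vorticity (h : IsNormalMode ν Pr R k σ Z W Θ)
    (hS : S.Represents ν Pr k) (hZ : ∃ z ∈ layer, Z z ≠ 0) : σ.im = 0 ∧ σ.re < 0 := by
  have hPr : 0 < Pr := hS.Pr_eq ▸ S.Pr_pos
  have hk : 0 < k ^ 2 := by
    have : k ≠ 0 := hS.k_eq ▸ S.k_ne_zero
    positivity
  have hDZ : ContDiffOn ℝ 1 (D Z) layer := contDiffOn_D h.contDiff_Z (by norm_num)
  let Y (a : ℂ) : Profile := rePart a Z h.contDiff_Z.continuousOn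
  let Y' (a : ℂ) : Profile := rePart a (D Z) hDZ.continuousOn
  let Y'' (a : ℂ) : Profile :=
    rePart a (D (D Z)) (contDiffOn_D (m := 0) hDZ (by norm_num)).continuousOn
  have hY (a : ℂ) : IsDeriv (Y a) (Y' a) :=
    isDeriv_rePart a _ _ (h.contDiff_Z.differentiableOn (by norm_num))
  have hY' (a : ℂ) : IsDeriv (Y' a) (Y'' a) :=
    isDeriv_rePart a _ _ (hDZ.differentiableOn (by norm_num))
  -- The vorticity operator is `(ν Z')' - k² ν Z`. Testing `Re(aZ)` with `Re(bZ)` gives a symmetric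
  -- left side: `a ≠ b` yields reality of `σ`, and `a = b` its sign.
  have weak (a b : ℂ) : integral (S.visc * Y' a * Y' b + k ^ 2 • S.visc * Y a * Y b)
      = -(Pr⁻¹ * (σ.re * integral (Y a * Y b) + σ.im * integral (Y (Complex.I * a) * Y b))) := by
    have hi := (((S.isDeriv_visc.mul (hY' a)).mul (hY b))).integral
    have h1 : Y b topPlate = 0 := rePart_eq_zero _ h.top.1
    have h2 : Y b bottomPlate = 0 := rePart_eq_zero _ h.bottom.1
    rw [ContinuousMap.mul_apply, ContinuousMap.mul_apply _ _ bottomPlate, h1, h2, mul_zero,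
      mul_zero, sub_zero] at hi
    rw [← sub_eq_zero, ← hi, mul_integral, mul_integral, ← map_add integral, mul_integral,
      ← map_neg integral, ← map_sub integral]
    congr 1
    ext z
    have hv : ((Pr⁻¹ : ℝ) : ℂ) * (σ * Z z) = (ν z : ℂ) * (D (D Z) z - ((k ^ 2 : ℝ) : ℂ) * Z z)
        + (dVisc ν z : ℂ) * D Z z := by
      push_cast
      linear_combination h.vorticity z z.2
    have hv' := congrArg (fun w => (a * w).re) hv
    simp only [Complex.mul_re,
      Complex.mul_im, Complex.add_re, Complex.add_im, Complex.sub_re, Complex.sub_im,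
      Complex.ofReal_re, Complex.ofReal_im] at hv'
    simp only [Y, Y', Y'', rePart_apply, ContinuousMap.add_apply, ContinuousMap.neg_apply,
      ContinuousMap.sub_apply, ContinuousMap.mul_apply, ContinuousMap.smul_apply, smul_eq_mul,
      hS.visc, hS.visc', Complex.mul_re, Complex.mul_im, Complex.I_re, Complex.I_im]
    linear_combination (b.re * (Z z).re - b.im * (Z z).im) * hv'
  have hsq (a : ℂ) : 0 ≤ integral (Y a * Y a) := integral_nonneg fun z => mul_self_nonneg _
  have hpos : ∃ a, 0 < integral (Y a * Y a)
      ∧ 0 < integral (S.visc * Y' a * Y' a + k ^ 2 • S.visc * Y a * Y a) := by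
    obtain ⟨z, hz, hZ⟩ := hZ
    have key (a : ℂ) (ha : Y a ⟨z, hz⟩ ≠ 0) : 0 < integral (Y a * Y a)
      ∧ 0 < integral (S.visc * Y' a * Y' a + k ^ 2 • S.visc * Y a * Y a) := by
      refine ⟨integral_pos (z := ⟨z, hz⟩) (fun z => mul_self_nonneg _) (mul_self_ne_zero.2 ha),
        integral_pos (z := ⟨z, hz⟩) (fun z => ?_) (ne_of_gt ?_)⟩
      all_goals
        simp only [ContinuousMap.add_apply, ContinuousMap.mul_apply, ContinuousMap.smul_apply,
          smul_eq_mul, mul_assoc]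
      · have h1 := S.visc_pos z
        have h2 := mul_self_nonneg (Y a z)
        have h3 := mul_self_nonneg (Y' a z)
        positivity
      · have h1 := S.visc_pos ⟨z, hz⟩
        have h2 := mul_self_pos.2 ha
        have h3 := mul_self_nonneg (Y' a ⟨z, hz⟩)
        positivity
    rcases re_ne_zero_or hZ with h1 | h1
    exacts [⟨1, key 1 h1⟩, ⟨Complex.I, key _ h1⟩]
  have him : σ.im = 0 := by
    have h1 := weak 1 Complex.I
    have h2 := weak Complex.I 1
    have e : Y (Complex.I * Complex.I) = -Y 1 := by
      ext z
      simp [Y, Complex.I_mul_I]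
    rw [e, neg_mul, map_neg] at h2
    rw [mul_one] at h1
    have e1 : S.visc * Y' 1 * Y' Complex.I + k ^ 2 • S.visc * Y 1 * Y Complex.I
      = S.visc * Y' Complex.I * Y' 1 + k ^ 2 • S.visc * Y Complex.I * Y 1 := by ring
    rw [e1, h2, mul_comm (Y 1) (Y Complex.I), neg_inj] at h1
    have h3 := mul_left_cancel₀ (inv_ne_zero hPr.ne') h1
    have h4 : σ.im * (integral (Y 1 * Y 1) + integral (Y Complex.I * Y Complex.I)) = 0 := by
      linarith
    refine (mul_eq_zero.1 h4).resolve_right fun h5 => ?_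
    obtain ⟨z, hz, hZ⟩ := hZ
    rcases re_ne_zero_or hZ with h6 | h6
    · linarith [hsq Complex.I, integral_pos (f := Y 1 * Y 1) (z := ⟨z, hz⟩)
        (fun z => mul_self_nonneg _) (mul_self_ne_zero.2 h6)]
    · linarith [hsq 1, integral_pos (f := Y Complex.I * Y Complex.I) (z := ⟨z, hz⟩)
        (fun z => mul_self_nonneg _) (mul_self_ne_zero.2 h6)]
  refine ⟨him, ?_⟩
  obtain ⟨a, ha, ha'⟩ := hpos
  rw [weak a a, him, zero_mul, add_zero] at ha'
  by_contra! hs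
  have : 0 ≤ Pr⁻¹ * (σ.re * integral (Y a * Y a)) := by positivity
  linarith

theorem IsEigenvalue.convective_or (h : IsEigenvalue ν Pr R k σ) (hS : S.Represents ν Pr k) :
    IsConvectiveEigenvalue ν Pr R k σ ∨ σ.im = 0 ∧ σ.re < 0 := by
  obtain ⟨Z, W, Θ, h, z, hz, hne⟩ := h
  by_cases hc : ∃ z ∈ layer, W z ≠ 0 ∨ Θ z ≠ 0
  · exact Or.inl ⟨Z, W, Θ, h, hc⟩
  · exact Or.inr (h.im_eq_zero_and_neg_of_vorticity hS
      ⟨z, hz, hne.resolve_right fun h' => hc ⟨z, hz, h'⟩⟩)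

end NormalMode
end Convection

/-! ### From real solutions back to normal modes. -/

namespace Convection
open Profile

theorem D_congr {f g : ℝ → ℂ} (h : Set.EqOn f g layer) {z : ℝ} (hz : z ∈ layer) : D f z = D g z :=
  derivWithin_congr h (h hz)

namespace Profile

theorem IsDeriv.D_ofReal {f f' : Profile} (h : IsDeriv f f') {z : ℝ} (hz : z ∈ layer) :
    D (fun y => (f.ext y : ℂ)) z = f'.ext z :=
  (h z hz).ofReal_comp.derivWithin (uniqueDiffOn_layer z hz)

theorem IsDeriv.D_D_ofReal {f f' f'' : Profile} (h : IsDeriv f f') (h' : IsDeriv f' f'') {z : ℝ}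
    (hz : z ∈ layer) : D (D (fun y => (f.ext y : ℂ))) z = f''.ext z := by
  rw [D_congr (fun _ hy => h.D_ofReal hy) hz, h'.D_ofReal hz]

theorem contDiffOn_ext_zero (f : Profile) : ContDiffOn ℝ 0 f.ext layer :=
  contDiffOn_zero.2 f.continuous_ext.continuousOn

theorem IsDeriv.contDiffOn_succ {f f' : Profile} (h : IsDeriv f f') {n : ℕ}
    (hf' : ContDiffOn ℝ n f'.ext layer) : ContDiffOn ℝ (n + 1 : ℕ) f.ext layer := by
  push_cast
  rw [contDiffOn_succ_iff_derivWithin uniqueDiffOn_layer]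
  refine ⟨fun z hz => (h z hz).differentiableWithinAt, by simp, hf'.congr fun z hz => ?_⟩
  exact (h z hz).derivWithin (uniqueDiffOn_layer z hz)

theorem contDiffOn_ofReal {f : Profile} {n : WithTop ℕ∞} (h : ContDiffOn ℝ n f.ext layer) :
    ContDiffOn ℝ n (fun z => (f.ext z : ℂ)) layer :=
  Complex.ofRealCLM.contDiff.comp_contDiffOn h

end Profile

variable {S : Medium} {ν : ℝ → ℝ} {Pr R k r σ : ℝ} {u : Perturbation}

theorem Medium.Represents.contDiffOn_fluidity (hS : S.Represents ν Pr k) :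
    ContDiffOn ℝ 2 S.fluidity.ext layer := by
  refine (hS.contDiff.inv fun z hz => ?_).congr fun z hz => ?_
  · rw [← hS.visc ⟨z, hz⟩]
    exact (S.visc_pos _).ne'
  · rw [ext_of_mem _ hz]
    exact congrArg _ (hS.visc ⟨z, hz⟩)

/-- A real solution of the homogeneous boundary value problem is a normal mode. -/
theorem Medium.IsSolution.isNormalMode (h : S.IsSolution r σ u 0) (hS : S.Represents ν Pr k)
    (hr0 : 0 < r) (hr : r ^ 2 = R * k ^ 2) :
    IsNormalMode ν Pr R k σ (fun _ => 0) (fun z => ((velocity u).ext z : ℂ))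
      (fun z => ((r⁻¹ • temperature u).ext z : ℂ)) := by
  obtain ⟨X₁, X₂, hX₁, hX₂, hX⟩ := h.momentum
  have hheat := h.heat
  simp only [map_zero, sub_zero, smul_zero, Prod.fst_zero, add_zero] at hX hheat
  have hν := hS.contDiff
  have hTd : IsDeriv (r⁻¹ • temperature u) (r⁻¹ • u.2) := (isDeriv_temperature u).smul _
  have hTd' := hheat.smul r⁻¹
  -- Regularity is recovered here: the stress and the reciprocal viscosity are both `C²`, hence so
  -- is `W''`, and `W` is `C⁴`.
  have hu1 : u.1 = S.fluidity * (S.visc * u.1) := by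
    rw [mul_left_comm, S.visc_mul_fluidity]
  have hcu1 : ContDiffOn ℝ (2 : ℕ) u.1.ext layer := by
    rw [hu1]
    exact hS.contDiffOn_fluidity.mul
      (hX₁.contDiffOn_succ (hX₂.contDiffOn_succ (contDiffOn_ext_zero X₂)))
  have hcW : ContDiffOn ℝ 4 (fun z => ((velocity u).ext z : ℂ)) layer :=
    contDiffOn_ofReal ((isDeriv_velocity u).contDiffOn_succ
      ((isDeriv_slope u).contDiffOn_succ hcu1))
  have hcΘ : ContDiffOn ℝ 2 (fun z => ((r⁻¹ • temperature u).ext z : ℂ)) layer :=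
    contDiffOn_ofReal (hTd.contDiffOn_succ (hTd'.contDiffOn_succ (contDiffOn_ext_zero _)))
  have hDW : ∀ z ∈ layer, D (fun z => ((velocity u).ext z : ℂ)) z = (slope u).ext z :=
    fun z hz => (isDeriv_velocity u).D_ofReal hz
  have hDDW : ∀ z ∈ layer, D (D fun z => ((velocity u).ext z : ℂ)) z = u.1.ext z :=
    fun z hz => (isDeriv_velocity u).D_D_ofReal (isDeriv_slope u) hz
  have hDZ : D (fun _ => 0) = fun _ => 0 := by
    ext z
    simp [D]
  refine ⟨contDiffOn_const, hcW, hcΘ, ?_, ?_, ?_, ⟨rfl, ?_, ?_, ?_⟩, ⟨rfl, ?_, ?_, ?_⟩⟩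
  · intro z _
    simp [hDZ]
  · intro z hz
    rw [hTd.D_D_ofReal hTd' hz, hS.k_eq]
    simp only [ext_of_mem _ hz, ContinuousMap.smul_apply, ContinuousMap.sub_apply, smul_eq_mul]
    push_cast
    have : (r : ℂ) ≠ 0 := by exact_mod_cast hr0.ne'
    field_simp
    ring
  · intro z hz
    have hX' : D (D (fun y => (ν y : ℂ) * D (D fun z => ((velocity u).ext z : ℂ)) y)) z
        = X₂.ext z := by
      rw [← hX₁.D_D_ofReal hX₂ hz]
      have hE : Set.EqOn (fun y => (ν y : ℂ) * D (D fun z => ((velocity u).ext z : ℂ)) y)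
          (fun y => ((S.visc * u.1).ext y : ℂ)) layer := by
        intro y hy
        simp only [hDDW y hy, ext_mul]
        rw [ext_of_mem S.visc hy, hS.visc]
        push_cast
        rfl
      exact D_congr (fun y hy => D_congr hE hy) hz
    rw [D_viscOp_eq hν (contDiffOn_D hcW (by norm_num)) hz,
      viscOp_eq hν (hcW.of_le (by norm_num)) hz, hX', hDDW z hz, hDW z hz, hX]
    simp only [ext_of_mem _ hz, ContinuousMap.smul_apply, ContinuousMap.sub_apply,
      ContinuousMap.add_apply, ContinuousMap.mul_apply, smul_eq_mul, hS.visc, hS.visc', hS.visc'',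
      hS.Pr_eq, hS.k_eq]
    have hR : (R : ℂ) * (k : ℂ) ^ 2 = (r : ℂ) ^ 2 := by exact_mod_cast hr.symm
    have : (r : ℂ) ≠ 0 := by exact_mod_cast hr0.ne'
    rw [hR]
    push_cast
    field_simp
    ring
  · rw [show (velocity u).ext (-(1 / 2)) = 0 from
      ((velocity u).ext_coe bottomPlate).trans (velocity_bottom u), Complex.ofReal_zero]
  · rw [hDW (-(1 / 2)) bottomPlate.2, show (slope u).ext (-(1 / 2)) = 0 from
      ((slope u).ext_coe bottomPlate).trans (slope_bottom u), Complex.ofReal_zero]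
  · rw [ext_smul, show (temperature u).ext (-(1 / 2)) = 0 from
      ((temperature u).ext_coe bottomPlate).trans (temperature_bottom u), mul_zero,
      Complex.ofReal_zero]
  · rw [show (velocity u).ext (1 / 2) = 0 from
      ((velocity u).ext_coe topPlate).trans h.mem.1, Complex.ofReal_zero]
  · have h0 : u.1 topPlate = 0 :=
      (mul_eq_zero.1 h.stress_top).resolve_left (S.visc_pos topPlate).ne'
    rw [hDDW (1 / 2) topPlate.2, show u.1.ext (1 / 2) = 0 from (u.1.ext_coe topPlate).trans h0,
      Complex.ofReal_zero]
  · rw [ext_smul, show (temperature u).ext (1 / 2) = 0 from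
      ((temperature u).ext_coe topPlate).trans h.mem.2, mul_zero, Complex.ofReal_zero]

/-- The maximum of the Rayleigh quotient is a convective eigenvalue. -/
theorem Medium.Represents.isConvectiveEigenvalue_growth (hS : S.Represents ν Pr k) (hr0 : 0 < r)
    (hr : r ^ 2 = R * k ^ 2) : IsConvectiveEigenvalue ν Pr R k (S.growth r : ℝ) := by
  obtain ⟨u, hu0, hu⟩ := S.exists_solution_growth r
  refine ⟨_, _, _, hu.isNormalMode hS hr0 hr, ?_⟩
  rcases velocity_ne_zero_or hu0 with h | h
  · obtain ⟨z, hz⟩ := DFunLike.ne_iff.1 h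
    refine ⟨z, z.2, Or.inl ?_⟩
    rw [ext_coe]
    exact_mod_cast hz
  · obtain ⟨z, hz⟩ := DFunLike.ne_iff.1 h
    refine ⟨z, z.2, Or.inr ?_⟩
    rw [ext_smul, ext_coe]
    exact_mod_cast mul_ne_zero (inv_ne_zero hr0.ne') hz

theorem represents_mediumOf (ν : ℝ → ℝ) (hν : ContDiffOn ℝ 2 ν layer)
    (hν_pos : ∀ z ∈ layer, 0 < ν z) (hν_convex : ConvexOn ℝ layer ν)
    (Pr : ℝ) (hPr : 0 < Pr) (k : ℝ) (hk : k ≠ 0) :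
    (mediumOf ν hν hν_pos hν_convex Pr hPr k hk).Represents ν Pr k :=
  ⟨hν, fun _ => rfl, fun _ => rfl, fun _ => rfl, rfl, rfl⟩

end Convection

/-! ### Return to the rescaled Rayleigh number. -/

open Convection

theorem corollary8 (ν : ℝ → ℝ) (hν : ContDiffOn ℝ 2 ν Convection.layer)
    (hν_pos : ∀ z ∈ Convection.layer, 0 < ν z) (hν_convex : ConvexOn ℝ Convection.layer ν)
    (Pr : ℝ) (hPr : 0 < Pr) (k : ℝ) (hk : k ≠ 0) :
    ∃ σhat : ℝ → ℝ,
      (∀ Rt : ℝ, 0 < Rt → Convection.IsGrowthRate ν Pr (k ^ 4 * Rt) k (k ^ 2 * σhat Rt)) ∧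
      (∃ Rt : ℝ, 0 < Rt ∧ 0 < σhat Rt) ∧
      (∃ Rt : ℝ, 0 < Rt ∧ σhat Rt < 0) ∧
      Convection.ExchangeOfStability ν Pr k σhat := by
  have hS := represents_mediumOf ν hν hν_pos hν_convex Pr hPr k hk
  set S := mediumOf ν hν hν_pos hν_convex Pr hPr k hk
  have hk2 : 0 < k ^ 2 := by positivity
  -- The positive root of `r² = R k²` for `R = k⁴ R̃`. It is increasing and continuous, so the sign
  -- change and continuity of `growth` carry over.
  let ρ : ℝ → ℝ := fun Rt => |k| ^ 3 * √Rt
  have hρ : ∀ {Rt : ℝ}, 0 < Rt → 0 < ρ Rt := fun h => by positivity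
  have hρ2 : ∀ {Rt : ℝ}, 0 < Rt → ρ Rt ^ 2 = k ^ 4 * Rt * k ^ 2 := fun {Rt} h => by
    calc ρ Rt ^ 2 = (|k| ^ 2) ^ 3 * √Rt ^ 2 := by ring
      _ = _ := by rw [Real.sq_sqrt h.le, sq_abs]; ring
  have hρ_cont : Continuous ρ := by fun_prop
  have hρ_lt : ∀ {x y : ℝ}, 0 < x → x < y → ρ x < ρ y := fun hx hxy => by
    have := Real.sqrt_lt_sqrt hx.le hxy
    simp only [ρ]
    gcongr
  have hgrowth : ∀ {Rt : ℝ} {σ : ℂ}, 0 < Rt → IsEigenvalue ν Pr (k ^ 4 * Rt) k σ →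
      σ.im = 0 ∧ (σ.re ≤ S.growth (ρ Rt) ∨ σ.re < 0) := fun hRt hσ => by
    rcases hσ.convective_or hS with h | h
    · have h' := h.im_eq_zero_and_le hS (hρ hRt) (hρ2 hRt)
      exact ⟨h'.1, Or.inl h'.2⟩
    · exact ⟨h.1, Or.inr h.2⟩
  obtain ⟨r₀, hr₀, h0, hlt, hgt⟩ := S.exists_critical
  let R₀ : ℝ := (r₀ / |k| ^ 3) ^ 2
  have hR₀ : 0 < R₀ := by positivity
  have hρR₀ : ρ R₀ = r₀ := by
    simp only [ρ, R₀]
    rw [Real.sqrt_sq (by positivity)]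
    field_simp
  have hneg : ∀ {Rt : ℝ}, 0 < Rt → Rt < R₀ → S.growth (ρ Rt) < 0 := fun h h' =>
    hlt _ (hρ h) (hρR₀ ▸ hρ_lt h h')
  have hpos : ∀ {Rt : ℝ}, R₀ < Rt → 0 < S.growth (ρ Rt) := fun h =>
    hgt _ (hρR₀ ▸ hρ_lt hR₀ h)
  refine ⟨fun Rt => S.growth (ρ Rt) / k ^ 2, fun Rt hRt => ?_,
    ⟨R₀ + 1, by positivity, div_pos (hpos (by linarith)) hk2⟩,
    ⟨R₀ / 2, by positivity, div_neg_of_neg_of_pos (hneg (by positivity) (by linarith)) hk2⟩,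
    fun Rt hRt σ hσ => (hgrowth hRt hσ).1, ?_, R₀, hR₀, fun Rt hRt hlt' => ⟨?_, fun σ hσ => ?_⟩,
    ⟨?_, ?_, fun σ hσ hne => ?_⟩, fun Rt hRt => div_pos (hpos hRt) hk2⟩
  · rw [mul_div_cancel₀ _ hk2.ne']
    refine ⟨⟨_, hS.isConvectiveEigenvalue_growth (hρ hRt) (hρ2 hRt), by simp⟩, ?_⟩
    rintro x ⟨σ, hσ, rfl⟩
    exact (hσ.im_eq_zero_and_le hS (hρ hRt) (hρ2 hRt)).2
  · exact ((S.continuous_growth.comp hρ_cont).div_const _).continuousOn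
  · exact div_neg_of_neg_of_pos (hneg hRt hlt') hk2
  · exact (hgrowth hRt hσ).2.elim (fun h => h.trans_lt (hneg hRt hlt')) id
  · simp only [hρR₀, h0, zero_div]
  · have h := hS.isConvectiveEigenvalue_growth (hρ hR₀) (hρ2 hR₀)
    rwa [hρR₀, h0, Complex.ofReal_zero] at h
  · obtain ⟨him, hre⟩ := hgrowth hR₀ hσ
    rw [hρR₀, h0] at hre
    -- At criticality the real part is at most 0, and a real eigenvalue with zero real part is 0
    -- itself.
    refine lt_of_le_of_ne (hre.elim id le_of_lt) fun h => hne (Complex.ext h him)
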